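/- A continuous map $f:[0,1]\to[0,1]$ is called unimodal with turning point $c\in(0,1)$ if it is strictly increasing on $[0,c]$ and strictly decreasing on $[c,1]$. It is called smooth unimodal of order $\ell>1$ if, in addition, $f$ is $C^3$ with $f'\neq 0$ on $[0,1]\setminus\{c\}$, and there are $C^3$ local diffeomorphisms $\phi,\psi$ near $0$ with $\phi(0)=c$, $\psi(0)=f(c)$ and $|\psi^{-1}\circ f\circ\phi(x)|=|x|^\ell$ for small $|x|$. For $T\subset[0,1]$ let $D(T)=\{x\in[0,1]: f^k(x)\in T\text{ for some }k\ge 1\}$, and for $x\in D(T)$ let $R_T(x)=f^{k(x)}(x)$, where $k(x)\geq 1$ is minimal with $f^{k(x)}(x)\in T$. A return domain of $T$ is a connected component of $D(T)\cap T$. Let $f$ be unimodal with $f(0)=f(1)=0$ and $f(c)>c$. Let $q$ be the fixed point of $f$ in $(c,1]$. For $x\in[0,1]\setminus\{c\}$ let $\hat x\in[0,1]$ be the point other than $x$ with $f(\hat x)=f(x)$, let $\hat c=c$, and let $\widehat J=\{\hat x:x\in J\}$ for $J\subset[0,1]$. Let $I_0=(\hat q,q)$. Inductively, if $I_k$ is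 defined and $c$ returns to $I_k$, let $I_{k+1}$ be the return domain of $I_k$ containing $c$, and if moreover $R_{I_k}(c)$ returns to $I_k$, let $J_{k+1}$ be the return domain of $I_k$ containing $R_{I_k}(c)$. Consider the following properties: 1. $f(c)>c$, $f^2(c)<\hat q$ and $f^3(c),f^5(c)\in I_0$; 2. $I_{k+1}$ and $J_{k+1}$ are defined and disjoint for all $k\ge 0$; 3. $R_{I_k}(I_{k+1})\supset I_{k+1}\ni c$ for all $k\ge 0$; 4. $R_{I_k}|_{I_{k+1}}=R_{I_{k-1}}^2|_{I_{k+1}}$ for all $k\ge 1$; 5. for all odd $k$, $R_{I_{k-1}}(J_{k+1})\subset\widehat J_k$ and $R_{I_k}|_{J_{k+1}}=R_{I_{k-1}}^2|_{J_{k+1}}$; 6. for all even $k\ge 2$, $R_{I_k}|_{J_{k+1}}=R_{I_{k-1}}|_{J_{k+1}}$. Let $r_0=3$, $t_0=2$ and, for $k\ge 0$, let $r_{k+1}=r_k+t_k$, and let $t_{k+1}=r_k$ if $k$ is odd and $t_{k+1}=r_{k+1}$ if $k$ is even. Then: (i) There is a smooth unimodal map $f:[0,1]\to[0,1]$ with $f(0)=f(1)=0$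 that has the properties (1)–(6). (ii) For each real $\ell>1$ there is $a\in(0,1)$ such that $f(x)=a(1-|2x-1|^\ell)$, $x\in[0,1]$, is a smooth unimodal map of order $\ell$ with turning point $c=\tfrac12$ and $f(0)=f(1)=0$, and has the properties (1)–(6). (iii) For every (continuous) unimodal map with $f(0)=f(1)=0$ that has the properties (1)–(6), and for every $k\ge 0$, the numbers $r_k$ and $t_k$ are the first return times of $c$ and of $R_{I_k}(c)$ to $I_k$, respectively. -/

import Mathlib

namespace UnimodalNest

open Set Filter Topology

/-- `f : [0,1] → [0,1]` (given by a function on `ℝ`, of which only the values on `[0,1]` matter)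
is a continuous unimodal map with turning point `c`. -/
structure IsUnimodal (f : ℝ → ℝ) (c : ℝ) : Prop where
  continuousOn : ContinuousOn f (Icc 0 1)
  mapsTo : MapsTo f (Icc 0 1) (Icc 0 1)
  turning_mem : c ∈ Ioo (0 : ℝ) 1
  strictMonoOn : StrictMonoOn f (Icc 0 c)
  strictAntiOn : StrictAntiOn f (Icc c 1)

/-- `c` is a non-flat critical point of `f` of order `ℓ`: there are `C³` local diffeomorphisms
`φ`, `ψ` near `0` with `φ 0 = c`, `ψ 0 = f c` and `|ψ⁻¹ ∘ f ∘ φ (x)| = |x| ^ ℓ` for small `x`. -/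
def IsNonflat (f : ℝ → ℝ) (c ℓ : ℝ) : Prop :=
  ∃ φ ψ : OpenPartialHomeomorph ℝ ℝ,
    (0 ∈ φ.source ∧ ContDiffOn ℝ 3 φ φ.source ∧ ContDiffOn ℝ 3 φ.symm φ.target ∧ φ 0 = c) ∧
    (0 ∈ ψ.source ∧ ContDiffOn ℝ 3 ψ ψ.source ∧ ContDiffOn ℝ 3 ψ.symm ψ.target ∧ ψ 0 = f c) ∧
    ∀ᶠ x in 𝓝 (0 : ℝ), |ψ.symm (f (φ x))| = |x| ^ ℓ

/-- Smooth unimodal maps of critical order `ℓ`: unimodal, `C³` with non-zero derivative outside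
the turning point `c`, and non-flat of order `ℓ > 1` at `c`. -/
structure IsSmoothUnimodal (f : ℝ → ℝ) (c ℓ : ℝ) : Prop extends IsUnimodal f c where
  contDiffOn : ContDiffOn ℝ 3 f (Icc 0 1 \ {c})
  deriv_ne_zero : ∀ x ∈ Icc (0 : ℝ) 1, x ≠ c → derivWithin f (Icc 0 1) x ≠ 0
  one_lt_order : 1 < ℓ
  nonflat : IsNonflat f c ℓ

/-- `D(T)`: the points of `[0,1]` that enter `T` after a positive time. -/
def entrySet (f : ℝ → ℝ) (T : Set ℝ) : Set ℝ :=
  {x | x ∈ Icc (0 : ℝ) 1 ∧ ∃ k : ℕ, 1 ≤ k ∧ f^[k] x ∈ T}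

/-- The first entry (or return) time of `x` into `T`; it is meaningful for `x ∈ D(T)`. -/
noncomputable def entryTime (f : ℝ → ℝ) (T : Set ℝ) (x : ℝ) : ℕ :=
  sInf {k : ℕ | 1 ≤ k ∧ f^[k] x ∈ T}

/-- The first entry map `R_T`; it is meaningful on `D(T)`, and it is the first return map of `T`
on `D(T) ∩ T`. -/
noncomputable def entryMap (f : ℝ → ℝ) (T : Set ℝ) (x : ℝ) : ℝ :=
  f^[entryTime f T x] x

/-- The return domain of `T` containing `x`: the component of `D(T) ∩ T` containing `x`
(the empty set if `x` does not belong to `D(T) ∩ T`). -/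
def returnDomain (f : ℝ → ℝ) (T : Set ℝ) (x : ℝ) : Set ℝ :=
  connectedComponentIn (entrySet f T ∩ T) x

open Classical in
/-- `x̂`: the preimage of `f x` in `[0,1]` other than `x`; it is `x` itself if there is none. For
a unimodal map with `f 0 = f 1 = 0`, there is exactly one if `x ≠ c` and none if `x = c`. -/
noncomputable def hat (f : ℝ → ℝ) (x : ℝ) : ℝ :=
  if h : ∃ y, y ∈ Icc (0 : ℝ) 1 ∧ f y = f x ∧ y ≠ x then h.choose else x

/-- `q`: the orientation-reversing fixed point of `f`, that is, the fixed point to the right of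
the turning point (it exists and is unique if `f` is unimodal and `f c > c`). -/
noncomputable def revFixedPt (f : ℝ → ℝ) (c : ℝ) : ℝ :=
  Classical.epsilon fun x => c < x ∧ x ≤ 1 ∧ f x = x

/-- The principal nest: `I₀ = (q̂, q)`, and `I_{k+1}` is the return domain of `I_k` containing
`c` (empty if `c` does not return to `I_k`). -/
noncomputable def nestI (f : ℝ → ℝ) (c : ℝ) : ℕ → Set ℝ
  | 0 => Ioo (hat f (revFixedPt f c)) (revFixedPt f c)
  | k + 1 => returnDomain f (nestI f c k) c

/-- `R_{I_k}`. -/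
noncomputable def nestR (f : ℝ → ℝ) (c : ℝ) (k : ℕ) : ℝ → ℝ :=
  entryMap f (nestI f c k)

/-- `J_{k+1}`: the return domain of `I_k` containing `R_{I_k}(c)`. There is no `J₀`; the value at
`0` is a dummy. -/
noncomputable def nestJ (f : ℝ → ℝ) (c : ℝ) : ℕ → Set ℝ
  | 0 => ∅
  | k + 1 => returnDomain f (nestI f c k) (nestR f c k c)

/-- `R_S|A = R_T^n|A` for first return maps: both sides are defined and equal at every point
of `A`. -/
def AgreesWithIterate (f : ℝ → ℝ) (S T : Set ℝ) (n : ℕ) (A : Set ℝ) : Prop :=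
  ∀ x ∈ A, x ∈ entrySet f S ∩ S ∧
    (∀ j < n, (entryMap f T)^[j] x ∈ entrySet f T ∩ T) ∧
    entryMap f S x = (entryMap f T)^[n] x

/-- The prescribed combinatorics of the principal nest. -/
structure NestCombinatorics (f : ℝ → ℝ) (c : ℝ) : Prop where
  /-- (1) `f(c) > c`, `f²(c) < q̂` and `f³(c), f⁵(c) ∈ I₀`. -/
  prop1 : c < f c ∧ f^[2] c < hat f (revFixedPt f c) ∧
    f^[3] c ∈ nestI f c 0 ∧ f^[5] c ∈ nestI f c 0
  /-- (2) `I_{k+1}` and `J_{k+1}` are defined (that is, `c` and `R_{I_k}(c)` return to `I_k`)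
  and disjoint. -/
  prop2 : ∀ k, c ∈ entrySet f (nestI f c k) ∩ nestI f c k ∧
    nestR f c k c ∈ entrySet f (nestI f c k) ∩ nestI f c k ∧
    Disjoint (nestI f c (k + 1)) (nestJ f c (k + 1))
  /-- (3) `R_{I_k}(I_{k+1}) ⊇ I_{k+1} ∋ c`. -/
  prop3 : ∀ k, nestI f c (k + 1) ⊆ nestR f c k '' nestI f c (k + 1) ∧ c ∈ nestI f c (k + 1)
  /-- (4) `R_{I_k} = R_{I_{k-1}}²` on `I_{k+1}` for `k ≥ 1`. -/
  prop4 : ∀ k, 1 ≤ k →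
    AgreesWithIterate f (nestI f c k) (nestI f c (k - 1)) 2 (nestI f c (k + 1))
  /-- (5) For odd `k`, `R_{I_{k-1}}(J_{k+1}) ⊆ Ĵ_k` and `R_{I_k} = R_{I_{k-1}}²` on `J_{k+1}`. -/
  prop5 : ∀ k, Odd k →
    nestR f c (k - 1) '' nestJ f c (k + 1) ⊆ hat f '' nestJ f c k ∧
    AgreesWithIterate f (nestI f c k) (nestI f c (k - 1)) 2 (nestJ f c (k + 1))
  /-- (6) For even `k ≥ 2`, `R_{I_k} = R_{I_{k-1}}` on `J_{k+1}`. -/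
  prop6 : ∀ k, 2 ≤ k → Even k →
    AgreesWithIterate f (nestI f c k) (nestI f c (k - 1)) 1 (nestJ f c (k + 1))

/-- The pair `(r_k, t_k)`: `r_0 = 3`, `t_0 = 2`, `r_{k+1} = r_k + t_k`, and `t_{k+1}` is `r_k` for
odd `k` and `r_{k+1}` for even `k`. -/
def rtPair : ℕ → ℕ × ℕ
  | 0 => (3, 2)
  | k + 1 => ((rtPair k).1 + (rtPair k).2,
      if Odd k then (rtPair k).1 else (rtPair k).1 + (rtPair k).2)

def rSeq (k : ℕ) : ℕ := (rtPair k).1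

def tSeq (k : ℕ) : ℕ := (rtPair k).2

theorem rSeq_zero : rSeq 0 = 3 := rfl

theorem tSeq_zero : tSeq 0 = 2 := rfl

theorem rSeq_succ (k : ℕ) : rSeq (k + 1) = rSeq k + tSeq k := rfl

theorem tSeq_succ (k : ℕ) : tSeq (k + 1) = if Odd k then rSeq k else rSeq (k + 1) := rfl

/-- The family `x ↦ a (1 - |2x - 1| ^ ℓ)`. -/
noncomputable def powerFamily (ℓ a : ℝ) (x : ℝ) : ℝ :=
  a * (1 - |2 * x - 1| ^ ℓ)

end UnimodalNest

/-! Return times. Every `I_k` is nice: its boundary points never enter it, so first return times are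
constant on return domains (`IsNice.entryTime_eq`). As `R_{I_k}(c)` lies outside `I_{k+1}`, the
point `c` needs at least two returns to `I_k`, of times `r_k` and `t_k`, before it is back in
`I_{k+1}`; by (4) two suffice. The point `R_{I_{k+1}}(c)` returns to `I_k` in time `r_k`. For odd
`k`, (6) stops there; for even `k`, (5) puts this return into the mirror image of `J_{k+1}`, whose
points have the same entry times as those of `J_{k+1}`, namely `t_k`. This is the induction
`entryTime_nest`.

Existence. Recentred at the turning point, the power family consists of even maps `F a`. A `Stage`
describes one level of the nest by two monotone branches, and a `Family` is a stage varying
continuously with `a`, in which the first return of `0` moves from one endpoint of the noncentral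
domain to the other. The side branch carries this motion to one from end to end of `(-E, E)`, so the
next critical return sweeps across any prescribed noncentral domain of the next level. A smaller
parameter interval therefore carries a family of the next level (`Family.exists_next`). Two patterns
are available for the new noncentral branch, and the parity of `k` selects the one demanded by (5)
or (6). Only continuity in `a` is needed, not monotone dependence.

The nested parameter intervals have a common point (`FamilyAt.exists_centredNest`), where the
constructed intervals turn out to be the true `I_k` and `J_k` (`SymmetricNest.nestCombinatorics`).
The induction starts from `exists_familyAt_zero`. -/

namespace UnimodalNest

open Set Filter Topology

/-! ### First entry times -/

section EntryTimes

variable {f : ℝ → ℝ} {S T : Set ℝ} {x y : ℝ} {n : ℕ}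

theorem entryTime_mem (hx : x ∈ entrySet f T) :
    1 ≤ entryTime f T x ∧ f^[entryTime f T x] x ∈ T :=
  Nat.sInf_mem (s := {k : ℕ | 1 ≤ k ∧ f^[k] x ∈ T}) hx.2

theorem entryTime_le (hn : 1 ≤ n) (h : f^[n] x ∈ T) : entryTime f T x ≤ n :=
  Nat.sInf_le (s := {k : ℕ | 1 ≤ k ∧ f^[k] x ∈ T}) ⟨hn, h⟩

theorem iterate_notMem_of_lt_entryTime (hn : 1 ≤ n) (h : n < entryTime f T x) :
    f^[n] x ∉ T := fun h' => absurd (entryTime_le hn h') (not_le.2 h)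

theorem isLeast_entryTime (hx : x ∈ entrySet f T) :
    IsLeast {k : ℕ | 1 ≤ k ∧ f^[k] x ∈ T} (entryTime f T x) :=
  ⟨entryTime_mem hx, fun _ hk => entryTime_le hk.1 hk.2⟩

theorem entryTime_eq (hn : 1 ≤ n) (h : f^[n] x ∈ T)
    (h' : ∀ j, 1 ≤ j → j < n → f^[j] x ∉ T) : entryTime f T x = n := by
  have hl : IsLeast {k : ℕ | 1 ≤ k ∧ f^[k] x ∈ T} n :=
    ⟨⟨hn, h⟩, fun k hk => not_lt.1 fun hlt => h' k hk.1 hlt hk.2⟩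
  exact hl.csInf_eq

theorem entryMap_mem (hx : x ∈ entrySet f T) : entryMap f T x ∈ T := (entryTime_mem hx).2

theorem entryTime_mono (hST : S ⊆ T) (hx : x ∈ entrySet f S) :
    entryTime f T x ≤ entryTime f S x :=
  entryTime_le (entryTime_mem hx).1 (hST (entryTime_mem hx).2)

theorem entryTime_congr (h : f x = f y) : entryTime f T x = entryTime f T y := by
  unfold entryTime
  congr 1
  ext k
  rcases k with _ | k
  · simp
  · simp [Function.iterate_succ_apply, h]

/-- An entry into a subset is either the first entry into the larger set, or it happens no earlier
than the second one. -/
theorem le_entryTime_of_subset (hST : S ⊆ T) (hx : x ∈ entrySet f S)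
    (h : entryMap f T x ∉ S) :
    entryTime f T x + entryTime f T (entryMap f T x) ≤ entryTime f S x := by
  have h1 := entryTime_mono hST hx
  have h2 := entryTime_mem hx
  have h3 : entryTime f T x ≠ entryTime f S x := by
    intro he
    apply h
    unfold entryMap
    rw [he]
    exact h2.2
  obtain ⟨m, hm⟩ := Nat.exists_eq_add_of_lt (lt_of_le_of_ne h1 h3)
  have h4 : entryTime f T (entryMap f T x) ≤ m + 1 := by
    apply entryTime_le (by omega)
    unfold entryMap
    rw [← Function.iterate_add_apply]
    have : m + 1 + entryTime f T x = entryTime f S x := by omega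
    rw [this]
    exact hST h2.2
  omega

end EntryTimes

/-! ### Nice sets and their return domains -/

/-- A nice set: it is open, and the points of its boundary never enter it. -/
structure IsNice (f : ℝ → ℝ) (T : Set ℝ) : Prop where
  isOpen : IsOpen T
  subset : T ⊆ Ioo 0 1
  notMem : ∀ z ∈ closure T, z ∉ T → ∀ j : ℕ, f^[j] z ∉ T

section Nice

variable {f : ℝ → ℝ} {T : Set ℝ} {x y z : ℝ}

theorem mem_connectedComponentIn_of_mem_closure {F : Set ℝ}
    (hz : z ∈ closure (connectedComponentIn F x)) (hzF : z ∈ F) :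
    z ∈ connectedComponentIn F x := by
  have hne : (connectedComponentIn F x).Nonempty := closure_nonempty_iff.1 ⟨z, hz⟩
  have hx : x ∈ F := connectedComponentIn_nonempty_iff.1 hne
  have hpre : IsPreconnected (insert z (connectedComponentIn F x)) :=
    isPreconnected_connectedComponentIn.subset_closure (subset_insert _ _)
      (insert_subset hz subset_closure)
  exact hpre.subset_connectedComponentIn (mem_insert_of_mem _ (mem_connectedComponentIn hx))
    (insert_subset hzF (connectedComponentIn_subset F x)) (mem_insert z _)

theorem continuousAt_iterate (hc : ContinuousOn f (Icc 0 1)) (hm : MapsTo f (Icc 0 1) (Icc 0 1))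
    (hx : x ∈ Ioo (0 : ℝ) 1) (n : ℕ) : ContinuousAt f^[n] x :=
  (hc.iterate hm n).continuousAt (Icc_mem_nhds hx.1 hx.2)

theorem IsNice.isOpen_inter (hT : IsNice f T) (hc : ContinuousOn f (Icc 0 1))
    (hm : MapsTo f (Icc 0 1) (Icc 0 1)) : IsOpen (entrySet f T ∩ T) := by
  rw [isOpen_iff_mem_nhds]
  rintro x ⟨⟨-, k, hk, hxk⟩, hxT⟩
  have h1 := continuousAt_iterate hc hm (hT.subset hxT) k
  filter_upwards [h1.preimage_mem_nhds (hT.isOpen.mem_nhds hxk), hT.isOpen.mem_nhds hxT]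
    with y hy hyT
  exact ⟨⟨Ioo_subset_Icc_self (hT.subset hyT), k, hk, hy⟩, hyT⟩

theorem returnDomain_subset : returnDomain f T x ⊆ entrySet f T ∩ T :=
  connectedComponentIn_subset _ _

/-- A boundary point missing from the component is not in `D(T) ∩ T`, or it could be adjoined to the
component. If it later entered the component, it would enter `T`, hence lie outside `T` but in its
closure, contradicting niceness of `T`. -/
theorem IsNice.returnDomain (hT : IsNice f T) (hc : ContinuousOn f (Icc 0 1))
    (hm : MapsTo f (Icc 0 1) (Icc 0 1)) : IsNice f (returnDomain f T x) where
  isOpen := (hT.isOpen_inter hc hm).connectedComponentIn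
  subset := fun _ hy => hT.subset (returnDomain_subset hy).2
  notMem := by
    intro z hz hzC j hj
    have hzF : z ∉ entrySet f T ∩ T := fun h => hzC (mem_connectedComponentIn_of_mem_closure hz h)
    have hzT : z ∈ closure T :=
      closure_mono (fun _ hy => (returnDomain_subset (f := f) (x := x) hy).2) hz
    have hjT := (returnDomain_subset hj).2
    rcases Nat.eq_zero_or_pos j with rfl | hj0
    · exact hzC hj
    · have hz01 : z ∈ Icc (0 : ℝ) 1 :=
        closure_minimal (hT.subset.trans Ioo_subset_Icc_self) isClosed_Icc hzT
      exact hT.notMem z hzT (fun h => hzF ⟨⟨hz01, j, hj0, hjT⟩, h⟩) j hjT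

/-- The first return time to a nice set is constant on each return domain. -/
theorem IsNice.entryTime_eq (hT : IsNice f T) (hc : ContinuousOn f (Icc 0 1))
    (hm : MapsTo f (Icc 0 1) (Icc 0 1)) (hy : y ∈ UnimodalNest.returnDomain f T x)
    (hz : z ∈ UnimodalNest.returnDomain f T x) : entryTime f T y = entryTime f T z := by
  refine (isPreconnected_connectedComponentIn (F := entrySet f T ∩ T) (x := x)).constant
    (f := entryTime f T) ?_ hy hz
  intro w hw
  apply ContinuousAt.continuousWithinAt
  obtain ⟨hwD, hwT⟩ := returnDomain_subset hw
  obtain ⟨hn, hwn⟩ := entryTime_mem hwD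
  set n := entryTime f T w with hndef
  have hcont := continuousAt_iterate hc hm (hT.subset hwT)
  have hev : ∀ᶠ v in 𝓝 w, ∀ j ∈ Finset.Ico 1 n, f^[j] v ∉ T := by
    rw [Filter.eventually_all_finset]
    intro j hj
    rw [Finset.mem_Ico] at hj
    have hjT : f^[j] w ∉ T := iterate_notMem_of_lt_entryTime hj.1 hj.2
    -- This iterate enters `T` later, which boundary points never do. So it avoids even the closure
    -- of `T`, and avoiding `T` before time `n` is an open condition.
    have hjc : f^[j] w ∉ closure T := by
      intro hcl
      apply hT.notMem _ hcl hjT (n - j)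
      rw [← Function.iterate_add_apply, Nat.sub_add_cancel hj.2.le]
      exact hwn
    filter_upwards [(hcont j).preimage_mem_nhds (isClosed_closure.isOpen_compl.mem_nhds hjc)]
      with v hv hvT
    exact hv (subset_closure hvT)
  have hev2 : ∀ᶠ v in 𝓝 w, entryTime f T v = n := by
    filter_upwards [hev, (hcont n).preimage_mem_nhds (hT.isOpen.mem_nhds hwn)] with v hv hvn
    exact UnimodalNest.entryTime_eq hn hvn fun j h1 h2 => hv j (Finset.mem_Ico.2 ⟨h1, h2⟩)
  exact (tendsto_pure.2 hev2).mono_right (pure_le_nhds n)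

end Nice

/-! ### Return times forced by the combinatorics -/

section ReturnTimes

variable {f : ℝ → ℝ} {c : ℝ}

theorem apply_hat (f : ℝ → ℝ) (x : ℝ) : f (hat f x) = f x := by
  unfold hat
  split_ifs with h
  · exact h.choose_spec.2.1
  · rfl

theorem IsUnimodal.revFixedPt_spec (hf : IsUnimodal f c) (h1 : f 1 = 0) (hc : c < f c) :
    c < revFixedPt f c ∧ revFixedPt f c ≤ 1 ∧ f (revFixedPt f c) = revFixedPt f c := by
  apply Classical.epsilon_spec (p := fun x => c < x ∧ x ≤ 1 ∧ f x = x)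
  have hsub : Icc c 1 ⊆ Icc (0 : ℝ) 1 := Icc_subset_Icc_left hf.turning_mem.1.le
  obtain ⟨x, hx, hfx⟩ := intermediate_value_Icc' hf.turning_mem.2.le
    ((hf.continuousOn.mono hsub).sub continuousOn_id)
    (show (0 : ℝ) ∈ Icc (f 1 - id 1) (f c - id c) by simp [h1, hc.le])
  have hfx' : f x = x := sub_eq_zero.1 hfx
  refine ⟨x, lt_of_le_of_ne hx.1 ?_, hx.2, hfx'⟩
  rintro rfl
  exact hc.ne' hfx'

theorem IsUnimodal.hat_revFixedPt_mem (hf : IsUnimodal f c) (h0 : f 0 = 0) (h1 : f 1 = 0)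
    (hc : c < f c) : hat f (revFixedPt f c) ∈ Ioo 0 c := by
  obtain ⟨hq1, hq2, hq3⟩ := hf.revFixedPt_spec h1 hc
  set q := revFixedPt f c
  have hc01 := hf.turning_mem
  have hqc : q < f c := by
    conv_lhs => rw [← hq3]
    exact hf.strictAntiOn ⟨le_rfl, hc01.2.le⟩ ⟨hq1.le, hq2⟩ hq1
  have hex : ∃ y, y ∈ Icc (0 : ℝ) 1 ∧ f y = f q ∧ y ≠ q := by
    have hsub : Icc 0 c ⊆ Icc (0 : ℝ) 1 := Icc_subset_Icc_right hc01.2.le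
    obtain ⟨y, hy, hfy⟩ := intermediate_value_Icc hc01.1.le (hf.continuousOn.mono hsub)
      (show q ∈ Icc (f 0) (f c) from ⟨by rw [h0]; linarith [hc01.1], hqc.le⟩)
    exact ⟨y, hsub hy, by rw [hfy, hq3], by rintro rfl; linarith [hy.2]⟩
  have hspec : hat f q ∈ Icc (0 : ℝ) 1 ∧ f (hat f q) = f q ∧ hat f q ≠ q := by
    unfold hat
    rw [dif_pos hex]
    exact hex.choose_spec
  obtain ⟨ha, hb, hd⟩ := hspec
  refine ⟨lt_of_le_of_ne ha.1 ?_, not_le.1 fun hle => hd ?_⟩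
  · intro h
    rw [← h, h0, hq3] at hb
    linarith [hc01.1]
  · exact hf.strictAntiOn.injOn ⟨hle, ha.2⟩ ⟨hq1.le, hq2⟩ hb

/-- Both endpoints land on the fixed point `q`, which is outside the open interval. -/
theorem isNice_nestI_zero (hf : IsUnimodal f c) (h0 : f 0 = 0) (h1 : f 1 = 0)
    (hc : c < f c) : IsNice f (nestI f c 0) := by
  obtain ⟨hq1, hq2, hq3⟩ := hf.revFixedPt_spec h1 hc
  have hh := hf.hat_revFixedPt_mem h0 h1 hc
  have hfh := apply_hat f (revFixedPt f c)
  have hlt : hat f (revFixedPt f c) < revFixedPt f c := hh.2.trans hq1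
  change IsNice f (Ioo _ _)
  refine ⟨isOpen_Ioo, Ioo_subset_Ioo hh.1.le hq2, fun z hz hzn j => ?_⟩
  rw [closure_Ioo hlt.ne] at hz
  have hfix : ∀ j : ℕ, f^[j] (revFixedPt f c) = revFixedPt f c :=
    fun j => Function.iterate_fixed hq3 j
  have hz' : z = hat f (revFixedPt f c) ∨ z = revFixedPt f c := by
    rcases eq_or_lt_of_le hz.1 with h | h
    · exact Or.inl h.symm
    · rcases eq_or_lt_of_le hz.2 with h' | h'
      · exact Or.inr h'
      · exact absurd ⟨h, h'⟩ hzn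
  rcases hz' with rfl | rfl
  · rcases j with _ | j
    · exact hzn
    · rw [Function.iterate_succ_apply, hfh, hq3, hfix]
      exact right_notMem_Ioo
  · rw [hfix]
    exact right_notMem_Ioo

theorem isNice_nestI (hf : IsUnimodal f c) (h0 : f 0 = 0) (h1 : f 1 = 0)
    (hc : c < f c) : ∀ k, IsNice f (nestI f c k)
  | 0 => isNice_nestI_zero hf h0 h1 hc
  | k + 1 => (isNice_nestI hf h0 h1 hc k).returnDomain hf.continuousOn hf.mapsTo

theorem tSeq_pos (k : ℕ) : 0 < tSeq k ∧ 0 < rSeq k := by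
  induction k with
  | zero => simp [tSeq_zero, rSeq_zero]
  | succ k ih =>
    rw [tSeq_succ, rSeq_succ]
    split_ifs <;> omega

/-- In `entryTime_nest` this tells a point with return time `t_k` from the points of `I_{k+1}`,
which have return time `r_k`. -/
theorem tSeq_lt_rSeq_of_even {k : ℕ} (hk : Even k) : tSeq k < rSeq k := by
  rcases k with _ | k
  · simp [tSeq_zero, rSeq_zero]
  · have hk' : Odd k := by
      rcases Nat.even_or_odd k with h | h
      · exact absurd hk (Nat.not_even_iff_odd.2 h.add_one)
      · exact h
    rw [tSeq_succ, rSeq_succ, if_pos hk']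
    have := (tSeq_pos k).1
    omega

theorem entryTime_nest_zero (hf : IsUnimodal f c) (h0 : f 0 = 0) (h1 : f 1 = 0)
    (hN : NestCombinatorics f c) :
    entryTime f (nestI f c 0) c = 3 ∧ entryTime f (nestI f c 0) (nestR f c 0 c) = 2 := by
  obtain ⟨hc, h2, h3, h5⟩ := hN.prop1
  obtain ⟨hq1, hq2, hq3⟩ := hf.revFixedPt_spec h1 hc
  have hh := hf.hat_revFixedPt_mem h0 h1 hc
  have hfh := apply_hat f (revFixedPt f c)
  have hc01 := hf.turning_mem
  set q := revFixedPt f c with hq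
  have hI : nestI f c 0 = Ioo (hat f q) q := rfl
  have hout : ∀ x ∈ Ioo (hat f q) q, q < f x := by
    intro x hx
    rcases le_total x c with hxc | hxc
    · have := hf.strictMonoOn ⟨hh.1.le, hh.2.le⟩ ⟨hh.1.le.trans hx.1.le, hxc⟩ hx.1
      rwa [hfh, hq3] at this
    · have := hf.strictAntiOn ⟨hxc, hx.2.le.trans hq2⟩ ⟨hq1.le, hq2⟩ hx.2
      rwa [hq3] at this
  have hqc := hout c ⟨hh.2, hq1⟩
  have hr : entryTime f (nestI f c 0) c = 3 := by
    refine entryTime_eq (by norm_num) h3 fun j hj1 hj2 => ?_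
    interval_cases j
    · exact fun h => absurd h.2 (not_lt.2 hqc.le)
    · exact fun h => absurd h.1 (not_lt.2 h2.le)
  refine ⟨hr, ?_⟩
  have hR : nestR f c 0 c = f^[3] c := by
    unfold nestR entryMap
    rw [hr]
  rw [hR]
  refine entryTime_eq (by norm_num) ?_ fun j hj1 hj2 => ?_
  · rw [← Function.iterate_add_apply]
    exact h5
  · interval_cases j
    exact fun h => absurd h.2 (not_lt.2 (hout _ h3).le)

theorem NestCombinatorics.nestI_succ_subset (k : ℕ) : nestI f c (k + 1) ⊆ nestI f c k :=
  fun _ hx => (returnDomain_subset hx).2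

theorem NestCombinatorics.nestR_mem_nestJ (hN : NestCombinatorics f c) (k : ℕ) :
    nestR f c k c ∈ nestJ f c (k + 1) :=
  mem_connectedComponentIn (hN.prop2 k).2.1

theorem NestCombinatorics.nestR_notMem (hN : NestCombinatorics f c) (k : ℕ) :
    nestR f c k c ∉ nestI f c (k + 1) :=
  fun h => disjoint_left.1 (hN.prop2 k).2.2 h (hN.nestR_mem_nestJ k)

theorem entryTime_nest (hf : IsUnimodal f c) (h0 : f 0 = 0) (h1 : f 1 = 0)
    (hN : NestCombinatorics f c) (k : ℕ) :
    entryTime f (nestI f c k) c = rSeq k ∧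
      entryTime f (nestI f c k) (nestR f c k c) = tSeq k := by
  induction k with
  | zero => exact entryTime_nest_zero hf h0 h1 hN
  | succ k ih =>
    obtain ⟨ihr, iht⟩ := ih
    have hnice := isNice_nestI hf h0 h1 hN.prop1.1
    have hsub := NestCombinatorics.nestI_succ_subset (f := f) (c := c) k
    have hconst : ∀ y ∈ nestI f c (k + 1), entryTime f (nestI f c k) y = rSeq k := by
      intro y hy
      rw [← ihr]
      exact (hnice k).entryTime_eq hf.continuousOn hf.mapsTo hy (hN.prop3 k).2
    have hconstJ : ∀ y ∈ nestJ f c (k + 1), entryTime f (nestI f c k) y = tSeq k := by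
      intro y hy
      rw [← iht]
      exact (hnice k).entryTime_eq hf.continuousOn hf.mapsTo hy (hN.nestR_mem_nestJ k)
    constructor
    · obtain ⟨hcD, -, heq⟩ := hN.prop4 (k + 1) (by omega) c (hN.prop3 (k + 1)).2
      -- The first return of `c` to `I_k` misses `I_{k+1}`, so the second one bounds the return time
      -- from below; (4) gives the upper bound.
      have hlow := le_entryTime_of_subset hsub hcD.1 (hN.nestR_notMem k)
      have hval : entryMap f (nestI f c (k + 1)) c = f^[tSeq k + rSeq k] c := by
        rw [heq, Function.iterate_add_apply]
        change f^[entryTime f (nestI f c k) (nestR f c k c)] (f^[entryTime f (nestI f c k) c] c) = _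
        rw [iht, ihr]
      have hup : entryTime f (nestI f c (k + 1)) c ≤ tSeq k + rSeq k := by
        apply entryTime_le
        · have := tSeq_pos k
          omega
        · rw [← hval]
          exact entryMap_mem hcD.1
      change _ + entryTime f (nestI f c k) (nestR f c k c) ≤ _ at hlow
      rw [iht, ihr] at hlow
      rw [rSeq_succ]
      omega
    · set x := nestR f c (k + 1) c with hx
      have hxI : x ∈ nestI f c (k + 1) := (hN.prop2 (k + 1)).2.1.2
      have hxJ : x ∈ nestJ f c (k + 2) := hN.nestR_mem_nestJ (k + 1)
      have hxr := hconst x hxI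
      rcases Nat.even_or_odd k with hk | hk
      · obtain ⟨hJ, hag⟩ := hN.prop5 (k + 1) hk.add_one
        obtain ⟨hxD, -, heq⟩ := hag x hxJ
        obtain ⟨z, hz, hzy⟩ := hJ ⟨x, hxJ, rfl⟩
        change hat f z = entryMap f (nestI f c k) x at hzy
        have hyt : entryTime f (nestI f c k) (entryMap f (nestI f c k) x) = tSeq k := by
          rw [← hconstJ z hz, ← hzy]
          exact entryTime_congr (apply_hat f z)
        -- Membership in `I_{k+1}` would force the return time `r_k`, whereas this point has `t_k <
        -- r_k`. Hence a second return to `I_k` is needed.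
        have hyI : entryMap f (nestI f c k) x ∉ nestI f c (k + 1) := by
          intro h
          have := hconst _ h
          rw [hyt] at this
          exact (tSeq_lt_rSeq_of_even hk).ne this
        have hlow := le_entryTime_of_subset hsub hxD.1 hyI
        have hval : entryMap f (nestI f c (k + 1)) x = f^[tSeq k + rSeq k] x := by
          rw [heq, Function.iterate_add_apply]
          change f^[entryTime f (nestI f c k) (entryMap f (nestI f c k) x)]
            (f^[entryTime f (nestI f c k) x] x) = _
          rw [hyt, hxr]
        have hup : entryTime f (nestI f c (k + 1)) x ≤ tSeq k + rSeq k := by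
          apply entryTime_le
          · have := tSeq_pos k
            omega
          · rw [← hval]
            exact entryMap_mem hxD.1
        rw [hyt, hxr] at hlow
        rw [tSeq_succ, if_neg (Nat.not_odd_iff_even.2 hk), rSeq_succ]
        omega
      · obtain ⟨hxD, -, heq⟩ := hN.prop6 (k + 1) (by have := hk.pos; omega) hk.add_one x hxJ
        have hlow := entryTime_mono hsub hxD.1
        have hval : entryMap f (nestI f c (k + 1)) x = f^[rSeq k] x := by
          rw [heq]
          change f^[entryTime f (nestI f c k) x] x = _
          rw [hxr]
        have hup : entryTime f (nestI f c (k + 1)) x ≤ rSeq k := by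
          apply entryTime_le (tSeq_pos k).2
          rw [← hval]
          exact entryMap_mem hxD.1
        rw [hxr] at hlow
        rw [tSeq_succ, if_pos hk]
        omega

theorem isLeast_return_times (hf : IsUnimodal f c) (h0 : f 0 = 0) (h1 : f 1 = 0)
    (hN : NestCombinatorics f c) (k : ℕ) :
    IsLeast {n : ℕ | 1 ≤ n ∧ f^[n] c ∈ nestI f c k} (rSeq k) ∧
      IsLeast {n : ℕ | 1 ≤ n ∧ f^[n] (nestR f c k c) ∈ nestI f c k} (tSeq k) := by
  obtain ⟨hr, ht⟩ := entryTime_nest hf h0 h1 hN k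
  rw [← hr, ← ht]
  exact ⟨isLeast_entryTime (hN.prop2 k).1.1, isLeast_entryTime (hN.prop2 k).2.1.1⟩

end ReturnTimes

/-! ### Continuous solutions and crossings over a parameter interval -/

section ContinuousFamilies

/-- This makes endpoints of return domains move continuously with the parameter. The solutions are
locally bounded, and each of their cluster points at `a` solves the equation at `a`, where the
solution is unique. -/
theorem exists_continuousOn_solution {K : Set ℝ} {G : ℝ → ℝ → ℝ} {u v y : ℝ → ℝ}
    (hG : Continuous fun p : ℝ × ℝ => G p.1 p.2) (hu : ContinuousOn u K) (hv : ContinuousOn v K)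
    (hy : ContinuousOn y K) (huv : ∀ a ∈ K, u a ≤ v a)
    (hanti : ∀ a ∈ K, StrictAntiOn (G a) (Icc (u a) (v a)))
    (hmem : ∀ a ∈ K, y a ∈ Icc (G a (v a)) (G a (u a))) :
    ∃ s : ℝ → ℝ, ContinuousOn s K ∧ ∀ a ∈ K, s a ∈ Icc (u a) (v a) ∧ G a (s a) = y a := by
  have hex : ∀ a, ∃ x, a ∈ K → x ∈ Icc (u a) (v a) ∧ G a x = y a := by
    intro a
    by_cases ha : a ∈ K
    · have hGa : Continuous (G a) := hG.comp (by fun_prop : Continuous fun x : ℝ => (a, x))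
      obtain ⟨x, hx, hxy⟩ := intermediate_value_Icc' (huv a ha) hGa.continuousOn (hmem a ha)
      exact ⟨x, fun _ => ⟨hx, hxy⟩⟩
    · exact ⟨0, fun h => absurd h ha⟩
  choose s hs using hex
  refine ⟨s, fun a ha => ?_, hs⟩
  have hua := hu a ha
  have hva := hv a ha
  refine (isCompact_Icc (a := u a - 1) (b := v a + 1)).tendsto_nhds_of_unique_mapClusterPt ?_ ?_
  · filter_upwards [self_mem_nhdsWithin, hua.eventually (lt_mem_nhds (sub_one_lt (u a))),
      hva.eventually (gt_mem_nhds (lt_add_one (v a)))] with b hb hub hvb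
    exact ⟨hub.le.trans (hs b hb).1.1, (hs b hb).1.2.trans hvb.le⟩
  · intro x _ hx
    obtain ⟨U, hU, hUx⟩ := mapClusterPt_iff_ultrafilter.1 hx
    have hK : ∀ᶠ b in (U : Filter ℝ), b ∈ K := hU self_mem_nhdsWithin
    have hid : Tendsto (fun b : ℝ => b) U (𝓝 a) :=
      tendsto_id.mono_left (hU.trans nhdsWithin_le_nhds)
    have h1 : u a ≤ x := le_of_tendsto_of_tendsto (hua.mono_left hU) hUx
      (hK.mono fun b hb => (hs b hb).1.1)
    have h2 : x ≤ v a := le_of_tendsto_of_tendsto hUx (hva.mono_left hU)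
      (hK.mono fun b hb => (hs b hb).1.2)
    have h3 : Tendsto (fun b => G b (s b)) U (𝓝 (G a x)) :=
      (hG.tendsto (a, x)).comp (hid.prodMk_nhds hUx)
    have h4 : Tendsto (fun b => G b (s b)) U (𝓝 (y a)) :=
      ((hy a ha).mono_left hU).congr' (hK.mono fun b hb => (hs b hb).2.symm)
    exact (hanti a ha).injOn ⟨h1, h2⟩ (hs a ha).1
      ((tendsto_nhds_unique h3 h4).trans (hs a ha).2.symm)

/-- The last zero. -/
theorem exists_last_zero {α β : ℝ} {z : ℝ → ℝ} (hαβ : α ≤ β) (hz : ContinuousOn z (Icc α β))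
    (h1 : z α ≤ 0) (h2 : 0 ≤ z β) :
    ∃ γ ∈ Icc α β, z γ = 0 ∧ ∀ a ∈ Icc γ β, 0 ≤ z a := by
  set S := {a ∈ Icc α β | z a ≤ 0} with hS
  have hSc : IsCompact S :=
    isCompact_Icc.of_isClosed_subset (hz.preimage_isClosed_of_isClosed isClosed_Icc isClosed_Iic)
      (fun a ha => ha.1)
  have hmax := hSc.isGreatest_sSup ⟨α, ⟨le_rfl, hαβ⟩, h1⟩
  set γ := sSup S
  obtain ⟨⟨hγ, hzγ⟩, hub⟩ := hmax
  have hpos : ∀ a ∈ Icc γ β, a ≠ γ → 0 < z a := by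
    intro a ha hne
    by_contra hcon
    exact hne (le_antisymm (hub ⟨⟨hγ.1.trans ha.1, ha.2⟩, not_lt.1 hcon⟩) ha.1)
  have hγ0 : z γ = 0 := by
    obtain ⟨b, hb, hzb⟩ := intermediate_value_Icc hγ.2
      (hz.mono (Icc_subset_Icc_left hγ.1)) (show (0 : ℝ) ∈ Icc (z γ) (z β) from ⟨hzγ, h2⟩)
    by_cases hbγ : b = γ
    · rw [← hbγ, hzb]
    · exact absurd hzb (hpos b hb hbγ).ne'
  refine ⟨γ, hγ, hγ0, fun a ha => ?_⟩
  by_cases haγ : a = γ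
  · rw [haγ, hγ0]
  · exact (hpos a ha haγ).le

/-- The first zero. -/
theorem exists_first_zero {α β : ℝ} {z : ℝ → ℝ} (hαβ : α ≤ β) (hz : ContinuousOn z (Icc α β))
    (h1 : z α ≤ 0) (h2 : 0 ≤ z β) :
    ∃ γ ∈ Icc α β, z γ = 0 ∧ ∀ a ∈ Icc α γ, z a ≤ 0 := by
  obtain ⟨γ, hγ, h3, h4⟩ := exists_last_zero (α := -β) (β := -α) (z := fun a => -z (-a))
    (by linarith) ((hz.comp continuousOn_neg fun a ha => ⟨by linarith [ha.2], by linarith [ha.1]⟩).neg)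
    (by simpa using h2) (by simpa using h1)
  refine ⟨-γ, ⟨by linarith [hγ.2], by linarith [hγ.1]⟩, by linarith, fun a ha => ?_⟩
  have := h4 (-a) ⟨by linarith [ha.2], by linarith [ha.1]⟩
  simp only [neg_neg] at this
  linarith

/-- Stop when `y` first meets `v`, then go back to the last earlier parameter at which it meets `u`.
-/
theorem exists_crossing_of_lt {α β : ℝ} {u v y : ℝ → ℝ} (hαβ : α ≤ β)
    (hu : ContinuousOn u (Icc α β)) (hv : ContinuousOn v (Icc α β))
    (hy : ContinuousOn y (Icc α β)) (huv : ∀ a ∈ Icc α β, u a < v a)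
    (hα : y α < u α) (hβ : v β < y β) :
    ∃ α' β', α < α' ∧ α' < β' ∧ β' < β ∧ y α' = u α' ∧ y β' = v β' ∧
      ∀ a ∈ Icc α' β', y a ∈ Icc (u a) (v a) := by
  have hα' := huv α ⟨le_rfl, hαβ⟩
  obtain ⟨β', hβ', hyβ, hle⟩ := exists_first_zero hαβ (hy.sub hv)
    (by simp only [Pi.sub_apply]; linarith) (by simp only [Pi.sub_apply]; linarith)
  simp only [Pi.sub_apply] at hyβ hle
  have hsub : Icc α β' ⊆ Icc α β := Icc_subset_Icc_right hβ'.2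
  have hβ'' := huv β' hβ'
  obtain ⟨α', hα', hyα, hge⟩ := exists_last_zero hβ'.1 ((hy.sub hu).mono hsub)
    (by simp only [Pi.sub_apply]; linarith) (by simp only [Pi.sub_apply]; linarith)
  simp only [Pi.sub_apply] at hyα hge
  refine ⟨α', β', lt_of_le_of_ne hα'.1 ?_, lt_of_le_of_ne hα'.2 ?_, lt_of_le_of_ne hβ'.2 ?_,
    by linarith, by linarith, fun a ha => ⟨?_, ?_⟩⟩
  · rintro rfl; linarith
  · rintro rfl; linarith
  · rintro rfl; linarith
  · linarith [hge a ha]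
  · linarith [hle a ⟨hα'.1.trans ha.1, ha.2⟩]

theorem exists_crossing {α β : ℝ} {u v y : ℝ → ℝ} (hαβ : α ≤ β)
    (hu : ContinuousOn u (Icc α β)) (hv : ContinuousOn v (Icc α β))
    (hy : ContinuousOn y (Icc α β)) (huv : ∀ a ∈ Icc α β, u a < v a)
    (h : (y α < u α ∧ v β < y β) ∨ (v α < y α ∧ y β < u β)) :
    ∃ α' β', α < α' ∧ α' < β' ∧ β' < β ∧
      ((y α' = u α' ∧ y β' = v β') ∨ (y α' = v α' ∧ y β' = u β')) ∧
      ∀ a ∈ Icc α' β', y a ∈ Icc (u a) (v a) := by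
  rcases h with h | h
  · obtain ⟨α', β', h1, h2, h3, h4, h5, h6⟩ := exists_crossing_of_lt hαβ hu hv hy huv h.1 h.2
    exact ⟨α', β', h1, h2, h3, Or.inl ⟨h4, h5⟩, h6⟩
  · obtain ⟨α', β', h1, h2, h3, h4, h5, h6⟩ := exists_crossing_of_lt hαβ hv.neg hu.neg hy.neg
      (fun a ha => neg_lt_neg (huv a ha)) (neg_lt_neg h.1) (neg_lt_neg h.2)
    exact ⟨α', β', h1, h2, h3, Or.inr ⟨neg_inj.1 h4, neg_inj.1 h5⟩,
      fun a ha => ⟨neg_le_neg_iff.1 (h6 a ha).2, neg_le_neg_iff.1 (h6 a ha).1⟩⟩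

theorem continuous_iterate_family {F : ℝ → ℝ → ℝ} (hF : Continuous fun p : ℝ × ℝ => F p.1 p.2)
    (n : ℕ) : Continuous fun p : ℝ × ℝ => (F p.1)^[n] p.2 := by
  induction n with
  | zero => exact continuous_snd
  | succ n ih =>
    simp only [Function.iterate_succ_apply']
    exact hF.comp (continuous_fst.prodMk ih)

end ContinuousFamilies

/-! ### One level of the nest and its successor -/

section Stages

/-- The branch of the first return map to `(-E, E)` on the interval bounded by `P` and `Q` (or on
its mirror image), for an even map `F`: it has time `t` and is a bijection onto `(-E, E)`. -/
structure Branch (F : ℝ → ℝ) (t : ℕ) (τ E P Q : ℝ) : Prop where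
  sign : τ = 1 ∨ τ = -1
  pos : 1 ≤ t
  lt : P < Q
  anti : StrictAntiOn (fun y => τ * F^[t] y) (Icc P Q)
  left : τ * F^[t] P = E
  right : τ * F^[t] Q = -E
  first : ∀ y ∈ Icc P Q, ∀ j, 1 ≤ j → j < t → E ≤ |F^[j] y|

/-- One level of the principal nest of an even map `F`, centred at the turning point `0`:
`(-E, E)` and its central return domain `(-D, D)` with time `r`, and the return domain
`-σ (P, Q)` with time `t` whose closure contains the first return of `0`. -/
structure Stage (F : ℝ → ℝ) (r t : ℕ) (σ τ E D P Q : ℝ) : Prop where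
  sign : σ = 1 ∨ σ = -1
  pos : 1 ≤ r
  D_pos : 0 < D
  D_le : D ≤ P
  Q_le : Q ≤ E
  anti : StrictAntiOn (fun y => -σ * F^[r] y) (Icc 0 D)
  right : -σ * F^[r] D = -E
  first : ∀ y ∈ Icc 0 D, ∀ j, 1 ≤ j → j < r → E ≤ |F^[j] y|
  side : Branch F t τ E P Q
  crit : -σ * F^[r] 0 ∈ Icc P Q

variable {F : ℝ → ℝ} {r t : ℕ} {σ τ E D P Q : ℝ}

theorem iterate_sign_mul (hF : ∀ y, F (-y) = F y) (hσ : σ = 1 ∨ σ = -1) {n : ℕ} (hn : 1 ≤ n)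
    (y : ℝ) : F^[n] (σ * y) = F^[n] y := by
  obtain ⟨m, rfl⟩ := Nat.exists_eq_add_of_le' hn
  rw [Function.iterate_succ_apply, Function.iterate_succ_apply]
  rcases hσ with rfl | rfl <;> simp [hF]

theorem neg_sign (hσ : σ = 1 ∨ σ = -1) : -σ = 1 ∨ -σ = -1 := by
  rcases hσ with rfl | rfl <;> simp

theorem abs_sign_mul (hσ : σ = 1 ∨ σ = -1) (y : ℝ) : |σ * y| = |y| := by
  rcases hσ with rfl | rfl <;> simp

namespace Stage

variable (hS : Stage F r t σ τ E D P Q)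
include hS

theorem D_lt_E : D < E := by
  have := hS.D_le
  have := hS.Q_le
  have := hS.side.lt
  linarith

/-- By evenness a sign can be inserted before any further positive iterate. Compositions can thus be
computed with the side domain normalised to `(P, Q)`, whatever side of `0` it is on. -/
theorem iterate_add (hF : ∀ y, F (-y) = F y) {j : ℕ} (hj : 1 ≤ j) (y : ℝ) :
    F^[r + j] y = F^[j] (-σ * F^[r] y) := by
  rw [iterate_sign_mul hF (neg_sign hS.sign) hj, ← Function.iterate_add_apply, add_comm]

theorem iterate_add' (hF : ∀ y, F (-y) = F y) {j : ℕ} (hj : 1 ≤ j) (y : ℝ) :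
    F^[r + j] y = F^[j] (-(-σ * F^[r] y)) := by
  rw [hS.iterate_add hF hj]
  conv_lhs => rw [← iterate_sign_mul hF (Or.inr rfl : (-1 : ℝ) = 1 ∨ (-1 : ℝ) = -1) hj]
  congr 1
  ring

/-- The pattern for (6): the central branch of the old level already lands in the new interval `(-D,
D)`. -/
theorem branch_same {P' Q' : ℝ} (hP' : P' ∈ Icc 0 D) (hQ' : Q' ∈ Icc 0 D)
    (hgP : -σ * F^[r] P' = D) (hgQ : -σ * F^[r] Q' = -D) :
    Branch F r (-σ) D P' Q' where
  sign := neg_sign hS.sign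
  pos := hS.pos
  lt := by
    by_contra hcon
    have := hS.anti.antitoneOn hQ' hP' (not_lt.1 hcon)
    simp only [hgP, hgQ] at this
    linarith [hS.D_pos]
  anti := hS.anti.mono (Icc_subset_Icc hP'.1 hQ'.2)
  left := hgP
  right := hgQ
  first := fun y hy j h1 h2 =>
    hS.D_lt_E.le.trans (hS.first y ⟨hP'.1.trans hy.1, hy.2.trans hQ'.2⟩ j h1 h2)

/-- The pattern for (5): the central branch lands in the mirror image of the old noncentral domain,
on which the side branch acts as on the domain itself because `F` is even. -/
theorem branch_comp (hF : ∀ y, F (-y) = F y) {P₁ P₂ P' Q' : ℝ} (hP₁ : P₁ ∈ Icc P Q)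
    (hP₂ : P₂ ∈ Icc P Q) (hhP : τ * F^[t] P₁ = D) (hhQ : τ * F^[t] P₂ = -D)
    (hP' : P' ∈ Icc 0 D) (hQ' : Q' ∈ Icc 0 D)
    (hgP : -σ * F^[r] P' = -P₁) (hgQ : -σ * F^[r] Q' = -P₂) :
    (∀ y ∈ Icc P' Q', σ * F^[r] y ∈ Icc P₁ P₂) ∧ Branch F (r + t) τ D P' Q' := by
  have h12 : P₁ < P₂ := by
    by_contra hcon
    have := hS.side.anti.antitoneOn hP₂ hP₁ (not_lt.1 hcon)
    simp only [hhP, hhQ] at this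
    linarith [hS.D_pos]
  have hlt : P' < Q' := by
    by_contra hcon
    have := hS.anti.antitoneOn hQ' hP' (not_lt.1 hcon)
    simp only [hgP, hgQ] at this
    linarith
  have hsub : Icc P' Q' ⊆ Icc 0 D := Icc_subset_Icc hP'.1 hQ'.2
  have himg : ∀ y ∈ Icc P' Q', σ * F^[r] y ∈ Icc P₁ P₂ := by
    intro y hy
    have h1 := hS.anti.antitoneOn hP' (hsub hy) hy.1
    have h2 := hS.anti.antitoneOn (hsub hy) hQ' hy.2
    simp only [hgP, hgQ] at h1 h2
    constructor <;> linarith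
  have himg' : ∀ y ∈ Icc P' Q', -(-σ * F^[r] y) ∈ Icc P Q := by
    intro y hy
    have := himg y hy
    have h : -(-σ * F^[r] y) = σ * F^[r] y := by ring
    rw [h]
    exact ⟨hP₁.1.trans this.1, this.2.trans hP₂.2⟩
  refine ⟨himg, hS.side.sign, hS.pos.trans (Nat.le_add_right _ _), hlt, ?_, ?_, ?_, ?_⟩
  · intro y hy z hz hyz
    simp only [hS.iterate_add' hF hS.side.pos]
    exact hS.side.anti (himg' y hy) (himg' z hz) (neg_lt_neg (hS.anti (hsub hy) (hsub hz) hyz))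
  · rw [hS.iterate_add' hF hS.side.pos, hgP, neg_neg, hhP]
  · rw [hS.iterate_add' hF hS.side.pos, hgQ, neg_neg, hhQ]
  · intro y hy j h1 h2
    rcases lt_trichotomy j r with h | rfl | h
    · exact hS.D_lt_E.le.trans (hS.first y (hsub hy) j h1 h)
    · rw [← abs_sign_mul hS.sign]
      exact hS.D_le.trans (hP₁.1.trans ((himg y hy).1.trans (le_abs_self _)))
    · obtain ⟨i, rfl⟩ := Nat.exists_eq_add_of_le h.le
      rw [hS.iterate_add' hF (by omega)]
      exact hS.D_lt_E.le.trans (hS.side.first _ (himg' y hy) i (by omega) (by omega))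

/-- The new central branch is the old one followed by the side branch: `-σ F^r` decreases on `[0,
D']` from the critical value to `P₁`, and `P₁` is sent to an endpoint of `(-D, D)`. The orientation
`τ` of the side branch becomes the new `σ`. -/
theorem next (hF : ∀ y, F (-y) = F y) {t' : ℕ} {τ' P₁ D' P' Q' : ℝ} (hP₁ : P₁ ∈ Icc P Q)
    (hhP : τ * F^[t] P₁ = D) (hD' : D' ∈ Icc 0 D) (hgD : -σ * F^[r] D' = P₁)
    (hB : Branch F t' τ' D P' Q') (hP' : 0 ≤ P') (hgP : -σ * F^[r] P' ≤ P) (hQ' : Q' < D)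
    (hX : -τ * F^[r + t] 0 ∈ Icc P' Q') :
    (∀ y ∈ Icc 0 D', -σ * F^[r] y ∈ Ioo P Q) ∧ Stage F (r + t) t' τ τ' D D' P' Q' := by
  have hDE := hS.D_lt_E
  have hP₁' : P < P₁ := by
    refine lt_of_le_of_ne hP₁.1 ?_
    rintro rfl
    have := hS.side.left
    linarith
  have hX' := hX
  rw [hS.iterate_add hF hS.side.pos] at hX'
  set X := -σ * F^[r] 0 with hXdef
  have hXm : X ∈ Icc P Q := hS.crit
  have hXQ : X < Q := by
    refine lt_of_le_of_ne hXm.2 ?_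
    intro h
    rw [h] at hX'
    have := hS.side.right
    linarith [hX'.2]
  -- `-τ F^t` equals `-D < 0` at `P₁`, but is at least `P' ≥ 0` at `X`.
  have hPX : P₁ < X := by
    by_contra hcon
    have := hS.side.anti.antitoneOn hXm hP₁ (not_lt.1 hcon)
    simp only [hhP] at this
    linarith [hX'.1, hS.D_pos]
  have himg : ∀ y ∈ Icc 0 D', -σ * F^[r] y ∈ Icc P₁ X := by
    intro y hy
    have hy' : y ∈ Icc 0 D := ⟨hy.1, hy.2.trans hD'.2⟩
    have h1 := hS.anti.antitoneOn ⟨le_rfl, hS.D_pos.le⟩ hy' hy.1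
    have h2 := hS.anti.antitoneOn hy' hD' hy.2
    simp only [hgD] at h1 h2
    exact ⟨h2, h1⟩
  have himg' : ∀ y ∈ Icc 0 D', -σ * F^[r] y ∈ Icc P Q := fun y hy =>
    ⟨hP₁.1.trans (himg y hy).1, (himg y hy).2.trans hXm.2⟩
  refine ⟨fun y hy => ⟨hP₁'.trans_le (himg y hy).1, (himg y hy).2.trans_lt hXQ⟩,
    hS.side.sign, hS.pos.trans (Nat.le_add_right _ _), ?_, ?_, hQ'.le, ?_, ?_, ?_, hB, hX⟩
  · refine lt_of_le_of_ne hD'.1 ?_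
    rintro rfl
    exact hPX.ne' hgD
  · by_contra hcon
    have hP'' : P' ∈ Icc 0 D := ⟨hP', (not_le.1 hcon).le.trans hD'.2⟩
    have := hS.anti.antitoneOn hP'' hD' (not_le.1 hcon).le
    simp only [hgD] at this
    linarith
  · intro y hy z hz hyz
    simp only [hS.iterate_add hF hS.side.pos]
    have := hS.side.anti (himg' z hz) (himg' y hy)
      (hS.anti ⟨hy.1, hy.2.trans hD'.2⟩ ⟨hz.1, hz.2.trans hD'.2⟩ hyz)
    simp only at this
    linarith
  · rw [hS.iterate_add hF hS.side.pos, hgD]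
    linarith
  · intro y hy j h1 h2
    rcases lt_trichotomy j r with h | rfl | h
    · exact hDE.le.trans (hS.first y ⟨hy.1, hy.2.trans hD'.2⟩ j h1 h)
    · rw [← abs_sign_mul (neg_sign hS.sign)]
      exact hS.D_le.trans ((himg' y hy).1.trans (le_abs_self _))
    · obtain ⟨i, rfl⟩ := Nat.exists_eq_add_of_le h.le
      rw [hS.iterate_add hF (by omega)]
      exact hDE.le.trans (hS.side.first _ (himg' y hy) i (by omega) (by omega))

end Stage

end Stages

/-! ### The inductive step over parameter intervals -/

section Families

/-- A stage that persists over a parameter interval, over which the first return of the turning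
point runs through the whole noncentral return domain. -/
structure Family (F : ℝ → ℝ → ℝ) (α β : ℝ) (E D P Q : ℝ → ℝ) (r t : ℕ) (σ τ : ℝ) : Prop where
  lt : α < β
  contE : ContinuousOn E (Icc α β)
  contD : ContinuousOn D (Icc α β)
  contP : ContinuousOn P (Icc α β)
  contQ : ContinuousOn Q (Icc α β)
  stage : ∀ a ∈ Icc α β, Stage (F a) r t σ τ (E a) (D a) (P a) (Q a)
  crit : (-σ * (F α)^[r] 0 = P α ∧ -σ * (F β)^[r] 0 = Q β) ∨
    (-σ * (F α)^[r] 0 = Q α ∧ -σ * (F β)^[r] 0 = P β)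

variable {F : ℝ → ℝ → ℝ} {α β σ τ : ℝ} {E D P Q : ℝ → ℝ} {r t : ℕ}

/-- On `[0, D]` the map `-σ F^r` descends from a value at least `P` to `-E`. The endpoint values
required by either pattern lie in between, so the branch exists over the whole parameter interval,
wherever the critical return sits in `[P, Q]`. -/
theorem Family.exists_branch (hc : Continuous fun p : ℝ × ℝ => F p.1 p.2)
    (he : ∀ a y, F a (-y) = F a y) (hS : Family F α β E D P Q r t σ τ) (b : Prop) [Decidable b]
    {P₁ P₂ : ℝ → ℝ} (hP₁c : ContinuousOn P₁ (Icc α β)) (hP₂c : ContinuousOn P₂ (Icc α β))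
    (hP₁ : ∀ a ∈ Icc α β, P₁ a ∈ Icc (P a) (Q a) ∧ τ * (F a)^[t] (P₁ a) = D a)
    (hP₂ : ∀ a ∈ Icc α β, P₂ a ∈ Icc (P a) (Q a) ∧ τ * (F a)^[t] (P₂ a) = -D a) :
    ∃ (τ' : ℝ) (P' Q' : ℝ → ℝ), ContinuousOn P' (Icc α β) ∧ ContinuousOn Q' (Icc α β) ∧
      ∀ a ∈ Icc α β, Branch (F a) (if b then r else r + t) τ' (D a) (P' a) (Q' a) ∧
        0 ≤ P' a ∧ -σ * (F a)^[r] (P' a) ≤ P a ∧ Q' a < D a ∧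
        (¬ b → ∀ y ∈ Icc (P' a) (Q' a), σ * (F a)^[r] y ∈ Ioo (P a) (Q a)) := by
  have hgc : Continuous fun p : ℝ × ℝ => -σ * (F p.1)^[r] p.2 :=
    continuous_const.mul (continuous_iterate_family hc r)
  have hP₁' : ∀ a ∈ Icc α β, P a < P₁ a := by
    intro a ha
    refine lt_of_le_of_ne (hP₁ a ha).1.1 fun h => ?_
    have h1 := (hP₁ a ha).2
    rw [← h, (hS.stage a ha).side.left] at h1
    linarith [(hS.stage a ha).D_lt_E]
  have hP₂' : ∀ a ∈ Icc α β, P₂ a < Q a := by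
    intro a ha
    refine lt_of_le_of_ne (hP₂ a ha).1.2 fun h => ?_
    have h1 := (hP₂ a ha).2
    rw [h, (hS.stage a ha).side.right] at h1
    linarith [(hS.stage a ha).D_lt_E]
  have hsol : ∀ y : ℝ → ℝ, ContinuousOn y (Icc α β) → (∀ a ∈ Icc α β, y a ∈ Icc (-E a) (P a)) →
      ∃ s : ℝ → ℝ, ContinuousOn s (Icc α β) ∧
        ∀ a ∈ Icc α β, s a ∈ Icc 0 (D a) ∧ -σ * (F a)^[r] (s a) = y a := by
    intro y hy hyE
    refine exists_continuousOn_solution (u := fun _ => 0) hgc continuousOn_const hS.contD hy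
      (fun a ha => (hS.stage a ha).D_pos.le) (fun a ha => (hS.stage a ha).anti) fun a ha => ?_
    rw [(hS.stage a ha).right]
    exact ⟨(hyE a ha).1, (hyE a ha).2.trans (hS.stage a ha).crit.1⟩
  have hltD : ∀ a ∈ Icc α β, ∀ s ∈ Icc 0 (D a), -E a < -σ * (F a)^[r] s → s < D a := by
    intro a ha s hs h
    refine lt_of_le_of_ne hs.2 fun h' => ?_
    rw [h', (hS.stage a ha).right] at h
    exact lt_irrefl _ h
  by_cases hb : b
  · simp only [if_pos hb]
    obtain ⟨P', hP'c, hP'⟩ := hsol D hS.contD fun a ha => by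
      have := hS.stage a ha
      exact ⟨by linarith [this.D_pos, this.D_lt_E], this.D_le⟩
    obtain ⟨Q', hQ'c, hQ'⟩ := hsol (fun a => -D a) hS.contD.neg fun a ha => by
      have := hS.stage a ha
      exact ⟨by linarith [this.D_pos, this.D_lt_E], by linarith [this.D_pos, this.D_le]⟩
    refine ⟨-σ, P', Q', hP'c, hQ'c, fun a ha => ?_⟩
    have hst := hS.stage a ha
    refine ⟨hst.branch_same (hP' a ha).1 (hQ' a ha).1 (hP' a ha).2 (hQ' a ha).2, (hP' a ha).1.1,
      (hP' a ha).2.trans_le hst.D_le, hltD a ha _ (hQ' a ha).1 ?_, fun h => absurd hb h⟩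
    rw [(hQ' a ha).2]
    linarith [hst.D_lt_E]
  · simp only [if_neg hb]
    obtain ⟨P', hP'c, hP'⟩ := hsol (fun a => -P₁ a) hP₁c.neg fun a ha => by
      have := hS.stage a ha
      have h1 := (hP₁ a ha).1
      exact ⟨by linarith [this.Q_le, h1.2], by linarith [this.D_pos, this.D_le, h1.1]⟩
    obtain ⟨Q', hQ'c, hQ'⟩ := hsol (fun a => -P₂ a) hP₂c.neg fun a ha => by
      have := hS.stage a ha
      have h1 := (hP₂ a ha).1
      exact ⟨by linarith [this.Q_le, h1.2], by linarith [this.D_pos, this.D_le, h1.1]⟩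
    refine ⟨τ, P', Q', hP'c, hQ'c, fun a ha => ?_⟩
    have hst := hS.stage a ha
    obtain ⟨himg, hB⟩ := hst.branch_comp (he a) (hP₁ a ha).1 (hP₂ a ha).1 (hP₁ a ha).2
      (hP₂ a ha).2 (hP' a ha).1 (hQ' a ha).1 (hP' a ha).2 (hQ' a ha).2
    refine ⟨hB, (hP' a ha).1.1, ?_, hltD a ha _ (hQ' a ha).1 ?_, fun _ y hy => ?_⟩
    · rw [(hP' a ha).2]
      linarith [hst.D_pos, hst.D_le, (hP₁ a ha).1.1]
    · rw [(hQ' a ha).2]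
      linarith [hst.Q_le, hP₂' a ha]
    · exact ⟨(hP₁' a ha).trans_le (himg y hy).1, (himg y hy).2.trans_lt (hP₂' a ha)⟩

/-- When the critical return is at `P`, its normalised successor is `-E`, below `P'`; when it is at
`Q`, the successor is `E`, above `Q'`. Between these parameters it crosses `[P', Q']`. -/
theorem Family.exists_next (hc : Continuous fun p : ℝ × ℝ => F p.1 p.2)
    (he : ∀ a y, F a (-y) = F a y) (hS : Family F α β E D P Q r t σ τ) (b : Prop) [Decidable b] :
    ∃ (α' β' τ' : ℝ) (D' P' Q' : ℝ → ℝ), α < α' ∧ β' < β ∧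
      Family F α' β' D D' P' Q' (r + t) (if b then r else r + t) τ τ' ∧
      ∀ a ∈ Icc α' β', Q' a < D a ∧
        (∀ y ∈ Icc 0 (D' a), -σ * (F a)^[r] y ∈ Ioo (P a) (Q a)) ∧
        (¬ b → ∀ y ∈ Icc (P' a) (Q' a), σ * (F a)^[r] y ∈ Ioo (P a) (Q a)) := by
  have hhc : Continuous fun p : ℝ × ℝ => τ * (F p.1)^[t] p.2 :=
    continuous_const.mul (continuous_iterate_family hc t)
  have hgc : Continuous fun p : ℝ × ℝ => -σ * (F p.1)^[r] p.2 :=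
    continuous_const.mul (continuous_iterate_family hc r)
  have hsol : ∀ y : ℝ → ℝ, ContinuousOn y (Icc α β) → (∀ a ∈ Icc α β, y a ∈ Icc (-E a) (E a)) →
      ∃ s : ℝ → ℝ, ContinuousOn s (Icc α β) ∧
        ∀ a ∈ Icc α β, s a ∈ Icc (P a) (Q a) ∧ τ * (F a)^[t] (s a) = y a := by
    intro y hy hyE
    refine exists_continuousOn_solution hhc hS.contP hS.contQ hy
      (fun a ha => (hS.stage a ha).side.lt.le) (fun a ha => (hS.stage a ha).side.anti)
      fun a ha => ?_
    rw [(hS.stage a ha).side.left, (hS.stage a ha).side.right]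
    exact hyE a ha
  obtain ⟨P₁, hP₁c, hP₁⟩ := hsol D hS.contD fun a ha => by
    have := hS.stage a ha
    exact ⟨by linarith [this.D_pos, this.D_lt_E], this.D_lt_E.le⟩
  obtain ⟨P₂, hP₂c, hP₂⟩ := hsol (fun a => -D a) hS.contD.neg fun a ha => by
    have := hS.stage a ha
    exact ⟨by linarith [this.D_lt_E], by linarith [this.D_pos, this.D_lt_E]⟩
  obtain ⟨τ', P', Q', hP'c, hQ'c, hB⟩ := hS.exists_branch hc he b hP₁c hP₂c hP₁ hP₂
  have hXc : Continuous fun a => -τ * (F a)^[r + t] 0 :=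
    continuous_const.mul ((continuous_iterate_family hc (r + t)).comp
      (by fun_prop : Continuous fun a : ℝ => (a, (0 : ℝ))))
  have hα : α ∈ Icc α β := ⟨le_rfl, hS.lt.le⟩
  have hβ : β ∈ Icc α β := ⟨hS.lt.le, le_rfl⟩
  have hXP : ∀ a ∈ Icc α β, -σ * (F a)^[r] 0 = P a → -τ * (F a)^[r + t] 0 < P' a := by
    intro a ha h
    have hst := hS.stage a ha
    rw [hst.iterate_add (he a) hst.side.pos, h, neg_mul, hst.side.left]
    linarith [hst.D_pos, hst.D_lt_E, (hB a ha).2.1]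
  have hXQ : ∀ a ∈ Icc α β, -σ * (F a)^[r] 0 = Q a → Q' a < -τ * (F a)^[r + t] 0 := by
    intro a ha h
    have hst := hS.stage a ha
    rw [hst.iterate_add (he a) hst.side.pos, h, neg_mul, hst.side.right]
    linarith [hst.D_pos, hst.D_lt_E, (hB a ha).2.2.2.1]
  obtain ⟨α', β', h1, h2, h3, h4, h5⟩ := exists_crossing hS.lt.le hP'c hQ'c hXc.continuousOn
    (fun a ha => (hB a ha).1.lt)
    (hS.crit.imp (fun h => ⟨hXP α hα h.1, hXQ β hβ h.2⟩) fun h => ⟨hXQ α hα h.1, hXP β hβ h.2⟩)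
  have hsub : Icc α' β' ⊆ Icc α β := Icc_subset_Icc h1.le h3.le
  obtain ⟨D', hD'c, hD'⟩ := exists_continuousOn_solution (K := Icc α' β') (u := fun _ => 0)
    (v := D) (y := P₁) hgc
    continuousOn_const (hS.contD.mono hsub) (hP₁c.mono hsub)
    (fun a ha => (hS.stage a (hsub ha)).D_pos.le) (fun a ha => (hS.stage a (hsub ha)).anti)
    (by
      intro a ha
      have hst := hS.stage a (hsub ha)
      rw [hst.right]
      refine ⟨by linarith [hst.D_pos, hst.D_lt_E, hst.D_le, (hP₁ a (hsub ha)).1.1], ?_⟩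
      -- If the critical return came before `P₁`, its normalised successor would be at most `-D`,
      -- hence below `P'`.
      by_contra hcon
      have hh := hst.side.anti.antitoneOn hst.crit (hP₁ a (hsub ha)).1 (not_le.1 hcon).le
      simp only [(hP₁ a (hsub ha)).2] at hh
      have hx := (h5 a ha).1
      rw [hst.iterate_add (he a) hst.side.pos] at hx
      linarith [hst.D_pos, (hB a (hsub ha)).2.1])
  have hnext := fun a (ha : a ∈ Icc α' β') =>
    (hS.stage a (hsub ha)).next (he a) (hP₁ a (hsub ha)).1 (hP₁ a (hsub ha)).2 (hD' a ha).1
      (hD' a ha).2 (hB a (hsub ha)).1 (hB a (hsub ha)).2.1 (hB a (hsub ha)).2.2.1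
      (hB a (hsub ha)).2.2.2.1 (h5 a ha)
  refine ⟨α', β', τ', D', P', Q', h1, h3, ⟨h2, hS.contD.mono hsub, hD'c, hP'c.mono hsub,
    hQ'c.mono hsub, fun a ha => (hnext a ha).2, h4⟩, fun a ha => ⟨(hB a (hsub ha)).2.2.2.1,
    (hnext a ha).1, (hB a (hsub ha)).2.2.2.2⟩⟩

/-- A family of stages at level `k`. -/
structure FamilyAt (F : ℝ → ℝ → ℝ) (k : ℕ) where
  α : ℝ
  β : ℝ
  σ : ℝ
  τ : ℝ
  E : ℝ → ℝ
  D : ℝ → ℝ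
  P : ℝ → ℝ
  Q : ℝ → ℝ
  isFamily : Family F α β E D P Q (rSeq k) (tSeq k) σ τ

/-- The stages of consecutive levels of a nest. -/
structure Linked {F : ℝ → ℝ → ℝ} {k : ℕ} (s : FamilyAt F k) (s' : FamilyAt F (k + 1)) : Prop where
  left_lt : s.α < s'.α
  lt_right : s'.β < s.β
  sign_eq : s'.σ = s.τ
  E_eq : s'.E = s.D
  Q_lt : ∀ a ∈ Icc s'.α s'.β, s'.Q a < s'.E a
  central : ∀ a ∈ Icc s'.α s'.β, ∀ y ∈ Icc 0 (s'.D a),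
    -s.σ * (F a)^[rSeq k] y ∈ Ioo (s.P a) (s.Q a)
  side : Even k → ∀ a ∈ Icc s'.α s'.β, ∀ y ∈ Icc (s'.P a) (s'.Q a),
    s.σ * (F a)^[rSeq k] y ∈ Ioo (s.P a) (s.Q a)

theorem FamilyAt.exists_next (hc : Continuous fun p : ℝ × ℝ => F p.1 p.2)
    (he : ∀ a y, F a (-y) = F a y) {k : ℕ} (s : FamilyAt F k) :
    ∃ s' : FamilyAt F (k + 1), Linked s s' := by
  -- The parity is that of the old level: odd `k` gives the direct pattern (6) at `k + 1`, even `k`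
  -- the composed pattern (5).
  obtain ⟨α', β', τ', D', P', Q', h1, h2, h3, h4⟩ := s.isFamily.exists_next hc he (Odd k)
  exact ⟨⟨α', β', s.τ, τ', s.D, D', P', Q', h3⟩, h1, h2, rfl, rfl, fun a ha => (h4 a ha).1,
    fun a ha => (h4 a ha).2.1, fun hk a ha => (h4 a ha).2.2 (Nat.not_odd_iff_even.2 hk)⟩

/-- The principal nest of an even map `F` centred at its turning point `0`, with the prescribed
combinatorics. -/
structure CentredNest (F : ℝ → ℝ) (σ τ E P Q : ℕ → ℝ) : Prop where
  stage : ∀ k, Stage F (rSeq k) (tSeq k) (σ k) (τ k) (E k) (E (k + 1)) (P k) (Q k)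
  sign_succ : ∀ k, σ (k + 1) = τ k
  Q_lt : ∀ k, Q (k + 1) < E (k + 1)
  central : ∀ k, ∀ y ∈ Icc 0 (E (k + 2)), -σ k * F^[rSeq k] y ∈ Ioo (P k) (Q k)
  side : ∀ k, Even k → ∀ y ∈ Icc (P (k + 1)) (Q (k + 1)), σ k * F^[rSeq k] y ∈ Ioo (P k) (Q k)

/-- The strict inclusions in `Linked` hold on the whole closed parameter interval of the later
level, so they are available at a common point of all the intervals. -/
theorem FamilyAt.exists_centredNest (hc : Continuous fun p : ℝ × ℝ => F p.1 p.2)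
    (he : ∀ a y, F a (-y) = F a y) (s : FamilyAt F 0) :
    ∃ a ∈ Icc s.α s.β, ∃ σ τ E P Q : ℕ → ℝ, CentredNest (F a) σ τ E P Q ∧ E 0 = s.E a := by
  choose next hnext using fun k (s : FamilyAt F k) => FamilyAt.exists_next hc he s
  let S : ∀ k, FamilyAt F k := fun k => Nat.rec s (fun k s => next k s) k
  have hS : ∀ k, Linked (S k) (S (k + 1)) := fun k => hnext k (S k)
  have hα : Monotone fun k => (S k).α := monotone_nat_of_le_succ fun k => (hS k).left_lt.le
  have hβ : Antitone fun k => (S k).β := antitone_nat_of_succ_le fun k => (hS k).lt_right.le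
  have hne := ciSup_mem_iInter_Icc_of_antitone_Icc (f := fun k => (S k).α) (g := fun k => (S k).β)
    (fun i j hij => Icc_subset_Icc (hα hij) (hβ hij)) fun k => (S k).isFamily.lt.le
  set a := ⨆ k, (S k).α
  have ha : ∀ k, a ∈ Icc (S k).α (S k).β := fun k => mem_iInter.1 hne k
  refine ⟨a, ha 0, fun k => (S k).σ, fun k => (S k).τ, fun k => (S k).E a, fun k => (S k).P a,
    fun k => (S k).Q a, ⟨fun k => ?_, fun k => (hS k).sign_eq, fun k => (hS k).Q_lt a (ha _),
    fun k y hy => ?_, fun k hk => (hS k).side hk a (ha _)⟩, rfl⟩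
  · have := (S k).isFamily.stage a (ha k)
    simpa only [(hS k).E_eq] using this
  · apply (hS k).central a (ha _)
    have := (hS (k + 1)).E_eq
    simpa only [this] using hy

end Families

/-! ### Recognising return domains by their endpoints -/

section Components

theorem connectedComponentIn_eq_Ioo {S : Set ℝ} {u v x : ℝ} (hsub : Ioo u v ⊆ S)
    (hx : x ∈ Ioo u v) (hu : u ∉ S) (hv : v ∉ S) : connectedComponentIn S x = Ioo u v := by
  have hxC : x ∈ connectedComponentIn S x := mem_connectedComponentIn (hsub hx)
  have hord := (isPreconnected_connectedComponentIn (F := S) (x := x)).ordConnected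
  refine Subset.antisymm (fun y hy => ⟨?_, ?_⟩)
    (isPreconnected_Ioo.subset_connectedComponentIn hx hsub)
  · by_contra hcon
    exact hu (connectedComponentIn_subset S x (hord.out hy hxC ⟨not_lt.1 hcon, hx.1.le⟩))
  · by_contra hcon
    exact hv (connectedComponentIn_subset S x (hord.out hxC hy ⟨hx.2.le, not_lt.1 hcon⟩))

end Components

section Boundary

variable {F : ℝ → ℝ} {r t : ℕ} {σ τ E D P Q : ℝ}

theorem iterate_abs (hF : ∀ y, F (-y) = F y) {n : ℕ} (hn : 1 ≤ n) (y : ℝ) :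
    F^[n] |y| = F^[n] y := by
  rcases abs_choice y with h | h
  · rw [h]
  · rw [h, ← neg_one_mul]
    exact iterate_sign_mul hF (Or.inr rfl) hn y

/-- Once the orbit hits `±E` it follows the orbit of `E`, by evenness. This applies to the endpoints
of return domains and shows that they never return. -/
theorem le_abs_iterate_of_hits {y : ℝ} (hF : ∀ y, F (-y) = F y)
    (hE : ∀ n, 1 ≤ n → E ≤ |F^[n] E|) (ht : |F^[t] y| = E)
    (hfirst : ∀ j, 1 ≤ j → j < t → E ≤ |F^[j] y|) : ∀ n, 1 ≤ n → E ≤ |F^[n] y| := by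
  intro n hn
  rcases lt_trichotomy n t with h | rfl | h
  · exact hfirst n hn h
  · exact ht.ge
  · obtain ⟨i, rfl⟩ := Nat.exists_eq_add_of_le h.le
    rw [add_comm, Function.iterate_add_apply, ← iterate_abs hF (by omega), ht]
    exact hE i (by omega)

theorem abs_eq_of_sign_mul (hσ : σ = 1 ∨ σ = -1) {x : ℝ} (hE : 0 ≤ E)
    (h : σ * x = E ∨ σ * x = -E) : |x| = E := by
  rw [← abs_sign_mul hσ]
  rcases h with h | h <;> rw [h]
  · exact abs_of_nonneg hE
  · rw [abs_neg, abs_of_nonneg hE]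

theorem Stage.E_pos (hS : Stage F r t σ τ E D P Q) : 0 < E := hS.D_pos.trans hS.D_lt_E

theorem Stage.abs_iterate_lt (hS : Stage F r t σ τ E D P Q) (hF : ∀ y, F (-y) = F y)
    (hX : -σ * F^[r] 0 < Q) {y : ℝ} (hy : |y| < D) :
    |F^[r] y| < E ∧ ∀ j, 1 ≤ j → j < r → E ≤ |F^[j] y| := by
  have hy' : |y| ∈ Icc 0 D := ⟨abs_nonneg y, hy.le⟩
  constructor
  · rw [← iterate_abs hF hS.pos, ← abs_sign_mul (neg_sign hS.sign), abs_lt]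
    have h1 := hS.anti hy' ⟨hS.D_pos.le, le_rfl⟩ hy
    have h2 := hS.anti.antitoneOn ⟨le_rfl, hS.D_pos.le⟩ hy' (abs_nonneg y)
    simp only [hS.right] at h1 h2
    exact ⟨h1, h2.trans_lt (hX.trans_le hS.Q_le)⟩
  · intro j h1 h2
    rw [← iterate_abs hF h1]
    exact hS.first _ hy' j h1 h2

theorem Branch.abs_iterate_lt (hB : Branch F t τ E P Q) (hF : ∀ y, F (-y) = F y)
    {y : ℝ} (hy : |y| ∈ Ioo P Q) :
    |F^[t] y| < E ∧ ∀ j, 1 ≤ j → j < t → E ≤ |F^[j] y| := by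
  have hy' : |y| ∈ Icc P Q := Ioo_subset_Icc_self hy
  constructor
  · rw [← iterate_abs hF hB.pos, ← abs_sign_mul hB.sign, abs_lt]
    have h1 := hB.anti hy' ⟨hB.lt.le, le_rfl⟩ hy.2
    have h2 := hB.anti ⟨le_rfl, hB.lt.le⟩ hy' hy.1
    simp only [hB.right, hB.left] at h1 h2
    exact ⟨h1, h2⟩
  · intro j h1 h2
    rw [← iterate_abs hF h1]
    exact hB.first _ hy' j h1 h2

end Boundary

/-! ### Properties (1)–(6) for a symmetric map -/

/-- A map `f` of the unit interval, symmetric about the turning point `1/2`, whose recentred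
version `F` has the prescribed principal nest. -/
structure SymmetricNest (f F : ℝ → ℝ) (σ τ E P Q : ℕ → ℝ) : Prop
    extends CentredNest F σ τ E P Q where
  apply_eq : ∀ y, f (1 / 2 + y) = 1 / 2 + F y
  even : ∀ y, F (-y) = F y
  continuous : Continuous F
  E_lt : E 0 < 1 / 2
  fixed : F (E 0) = E 0
  revFixedPt_eq : revFixedPt f (1 / 2) = 1 / 2 + E 0
  hat_eq : ∀ x ∈ Icc (0 : ℝ) 1, hat f x = 1 - x
  critical_pos : 0 < F 0
  critical_iterate_lt : F (F 0) < -E 0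

namespace SymmetricNest

variable {f F : ℝ → ℝ} {σ τ E P Q : ℕ → ℝ}

section

variable (hN : SymmetricNest f F σ τ E P Q)
include hN

theorem iterate_eq (n : ℕ) (y : ℝ) : f^[n] (1 / 2 + y) = 1 / 2 + F^[n] y := by
  have h : Function.Semiconj (fun y : ℝ => 1 / 2 + y) F f := fun y => (hN.apply_eq y).symm
  exact ((h.iterate_right n) y).symm

theorem E_succ_lt (k : ℕ) : E (k + 1) < E k := (hN.stage k).D_lt_E

theorem E_lt_half (k : ℕ) : E k < 1 / 2 := by
  induction k with
  | zero => exact hN.E_lt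
  | succ k ih => exact (hN.E_succ_lt k).trans ih

theorem E_pos (k : ℕ) : 0 < E k := (hN.stage k).E_pos

/-- Strictness comes from the next level, whose central domain contains `0`. -/
theorem crit_mem (k : ℕ) : -σ k * F^[rSeq k] 0 ∈ Ioo (P k) (Q k) :=
  hN.central k 0 ⟨le_rfl, (hN.E_pos _).le⟩

theorem le_abs_iterate (k : ℕ) : ∀ n, 1 ≤ n → E k ≤ |F^[n] (E k)| := by
  induction k with
  | zero =>
    intro n _
    rw [Function.iterate_fixed hN.fixed]
    exact le_abs_self _
  | succ k ih =>
    have hS := hN.stage k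
    have := le_abs_iterate_of_hits hN.even ih
      (abs_eq_of_sign_mul (neg_sign hS.sign) hS.E_pos.le (Or.inr hS.right))
      (hS.first _ ⟨hS.D_pos.le, le_rfl⟩)
    exact fun n hn => (hN.E_succ_lt k).le.trans (this n hn)

theorem mem_unit {k : ℕ} {y : ℝ} (hy : |y| < E k) : 1 / 2 + y ∈ Icc (0 : ℝ) 1 := by
  have h1 := hN.E_lt_half k
  have h2 := abs_lt.1 hy
  constructor <;> linarith [h2.1, h2.2]

/-- Membership in the return set of a symmetric interval, in centred coordinates. -/
theorem return_of_abs {k n : ℕ} {y : ℝ} {I : Set ℝ} (hI : I = Ioo (1 / 2 - E k) (1 / 2 + E k))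
    (hy : |y| < E k) (hn : 1 ≤ n)
    (h : |F^[n] y| < E k ∧ ∀ j, 1 ≤ j → j < n → E k ≤ |F^[j] y|) :
    1 / 2 + y ∈ entrySet f I ∩ I ∧ entryTime f I (1 / 2 + y) = n ∧
      entryMap f I (1 / 2 + y) = 1 / 2 + F^[n] y := by
  have hmem : ∀ z, 1 / 2 + z ∈ I ↔ |z| < E k := by
    intro z
    rw [hI, abs_lt]
    constructor <;> rintro ⟨h1, h2⟩ <;> constructor <;> linarith
  have hret : f^[n] (1 / 2 + y) ∈ I := by
    rw [hN.iterate_eq, hmem]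
    exact h.1
  have ht : entryTime f I (1 / 2 + y) = n := by
    refine entryTime_eq hn hret fun j h1 h2 => ?_
    rw [hN.iterate_eq, hmem, not_lt]
    exact h.2 j h1 h2
  refine ⟨⟨⟨hN.mem_unit hy, n, hn, hret⟩, (hmem y).2 hy⟩, ht, ?_⟩
  unfold entryMap
  rw [ht, hN.iterate_eq]

theorem notMem_entrySet {k : ℕ} {y : ℝ} {I : Set ℝ} (hI : I = Ioo (1 / 2 - E k) (1 / 2 + E k))
    (h : ∀ n, 1 ≤ n → E k ≤ |F^[n] y|) : 1 / 2 + y ∉ entrySet f I ∩ I := by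
  rintro ⟨⟨-, n, hn, hmem⟩, -⟩
  rw [hN.iterate_eq, hI] at hmem
  have : |F^[n] y| < E k := abs_lt.2 ⟨by linarith [hmem.1], by linarith [hmem.2]⟩
  exact absurd (h n hn) (not_le.2 this)

theorem iterate_neg {n : ℕ} (hn : 1 ≤ n) (y : ℝ) : F^[n] (-y) = F^[n] y := by
  rw [← iterate_abs hN.even hn, abs_neg, iterate_abs hN.even hn]

/-- Interior points return with time `r_k`, while the endpoints hit the boundary of `I_k` and so
never enter it; hence the interval is the whole component. -/
theorem nestI_eq (k : ℕ) : nestI f (1 / 2) k = Ioo (1 / 2 - E k) (1 / 2 + E k) := by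
  induction k with
  | zero =>
    change Ioo (hat f (revFixedPt f (1 / 2))) (revFixedPt f (1 / 2)) = _
    have h0 := hN.E_pos 0
    have h1 := hN.E_lt
    rw [hN.revFixedPt_eq, hN.hat_eq _ ⟨by linarith, by linarith⟩]
    congr 1
    ring
  | succ k ih =>
    have hS := hN.stage k
    have hDE := hN.E_succ_lt k
    have hbd := le_abs_iterate_of_hits hN.even (hN.le_abs_iterate k)
      (abs_eq_of_sign_mul (neg_sign hS.sign) hS.E_pos.le (Or.inr hS.right))
      (hS.first _ ⟨hS.D_pos.le, le_rfl⟩)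
    refine connectedComponentIn_eq_Ioo (fun x hx => ?_)
      ⟨by linarith [hN.E_pos (k + 1)], by linarith [hN.E_pos (k + 1)]⟩ ?_
      (hN.notMem_entrySet ih hbd)
    · have hx' : |x - 1 / 2| < E (k + 1) := abs_lt.2 ⟨by linarith [hx.1], by linarith [hx.2]⟩
      have := (hN.return_of_abs ih (hx'.trans hDE) hS.pos
        (hS.abs_iterate_lt hN.even (hN.crit_mem k).2 hx')).1
      rwa [add_sub_cancel] at this
    · rw [sub_eq_add_neg]
      refine hN.notMem_entrySet ih fun n hn => ?_
      rw [hN.iterate_neg hn]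
      exact hbd n hn

theorem mem_nestI {k : ℕ} {y : ℝ} : 1 / 2 + y ∈ nestI f (1 / 2) k ↔ |y| < E k := by
  rw [hN.nestI_eq, abs_lt]
  constructor <;> rintro ⟨h1, h2⟩ <;> constructor <;> linarith

theorem central_return {k : ℕ} {y : ℝ} (hy : |y| < E (k + 1)) :
    1 / 2 + y ∈ entrySet f (nestI f (1 / 2) k) ∩ nestI f (1 / 2) k ∧
      nestR f (1 / 2) k (1 / 2 + y) = 1 / 2 + F^[rSeq k] y :=
  have h := hN.return_of_abs (hN.nestI_eq k) (hy.trans (hN.E_succ_lt k)) (hN.stage k).pos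
    ((hN.stage k).abs_iterate_lt hN.even (hN.crit_mem k).2 hy)
  ⟨h.1, h.2.2⟩

theorem side_return {k : ℕ} {y : ℝ} (hy : |y| ∈ Ioo (P k) (Q k)) :
    1 / 2 + y ∈ entrySet f (nestI f (1 / 2) k) ∩ nestI f (1 / 2) k ∧
      nestR f (1 / 2) k (1 / 2 + y) = 1 / 2 + F^[tSeq k] y :=
  have h := hN.return_of_abs (hN.nestI_eq k) (hy.2.trans_le (hN.stage k).Q_le)
    (hN.stage k).side.pos ((hN.stage k).side.abs_iterate_lt hN.even hy)
  ⟨h.1, h.2.2⟩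

theorem abs_mem_of_sign_mul_mem {k : ℕ} {s y : ℝ} (hs : s = 1 ∨ s = -1)
    (hy : s * y ∈ Ioo (P k) (Q k)) : |y| ∈ Ioo (P k) (Q k) := by
  rw [← abs_sign_mul hs, abs_of_pos]
  · exact hy
  · exact (((hN.stage k).D_pos.trans_le (hN.stage k).D_le)).trans hy.1

theorem nestR_crit (k : ℕ) : nestR f (1 / 2) k (1 / 2) = 1 / 2 + F^[rSeq k] 0 := by
  have := (hN.central_return (k := k) (y := 0) (by simpa using hN.E_pos (k + 1))).2
  rwa [add_zero] at this

theorem abs_crit_mem (k : ℕ) : |F^[rSeq k] 0| ∈ Ioo (P k) (Q k) :=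
  hN.abs_mem_of_sign_mul_mem (neg_sign (hN.stage k).sign) (hN.crit_mem k)

/-- The first return of the turning point lies on the side given by `-σ k`, and the endpoints never
return. The two signs differ only in the order of the endpoints. -/
theorem mem_nestJ {k : ℕ} {y : ℝ} :
    1 / 2 + y ∈ nestJ f (1 / 2) (k + 1) ↔ -σ k * y ∈ Ioo (P k) (Q k) := by
  have hS := hN.stage k
  have hP := le_abs_iterate_of_hits hN.even (hN.le_abs_iterate k)
    (abs_eq_of_sign_mul hS.side.sign hS.E_pos.le (Or.inl hS.side.left))
    (hS.side.first _ ⟨le_rfl, hS.side.lt.le⟩)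
  have hQ := le_abs_iterate_of_hits hN.even (hN.le_abs_iterate k)
    (abs_eq_of_sign_mul hS.side.sign hS.E_pos.le (Or.inr hS.side.right))
    (hS.side.first _ ⟨hS.side.lt.le, le_rfl⟩)
  have hcr := hN.crit_mem k
  change _ ∈ connectedComponentIn _ (nestR f (1 / 2) k (1 / 2)) ↔ _
  rw [hN.nestR_crit]
  have hret : ∀ x, -σ k * (x - 1 / 2) ∈ Ioo (P k) (Q k) →
      x ∈ entrySet f (nestI f (1 / 2) k) ∩ nestI f (1 / 2) k := by
    intro x hx
    have := (hN.side_return (hN.abs_mem_of_sign_mul_mem (neg_sign hS.sign) hx)).1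
    rwa [add_sub_cancel] at this
  rcases hS.sign with h | h
  · rw [h] at hret hcr ⊢
    rw [connectedComponentIn_eq_Ioo (u := 1 / 2 + -Q k) (v := 1 / 2 + -P k)
      (fun x hx => hret x ⟨by linarith [hx.2], by linarith [hx.1]⟩)
      ⟨by linarith [hcr.2], by linarith [hcr.1]⟩
      (hN.notMem_entrySet (hN.nestI_eq k) fun n hn => by rw [hN.iterate_neg hn]; exact hQ n hn)
      (hN.notMem_entrySet (hN.nestI_eq k) fun n hn => by rw [hN.iterate_neg hn]; exact hP n hn)]
    constructor <;> rintro ⟨h1, h2⟩ <;> constructor <;> linarith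
  · rw [h] at hret hcr ⊢
    rw [connectedComponentIn_eq_Ioo (u := 1 / 2 + P k) (v := 1 / 2 + Q k)
      (fun x hx => hret x ⟨by linarith [hx.1], by linarith [hx.2]⟩)
      ⟨by linarith [hcr.1], by linarith [hcr.2]⟩
      (hN.notMem_entrySet (hN.nestI_eq k) hP) (hN.notMem_entrySet (hN.nestI_eq k) hQ)]
    constructor <;> rintro ⟨h1, h2⟩ <;> constructor <;> linarith

theorem nestJ_abs {k : ℕ} {y : ℝ} (hy : 1 / 2 + y ∈ nestJ f (1 / 2) (k + 1)) :
    |y| ∈ Ioo (P k) (Q k) :=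
  hN.abs_mem_of_sign_mul_mem (neg_sign (hN.stage k).sign) (hN.mem_nestJ.1 hy)

/-- The common mechanism of (4) and (5): one return by the central branch, landing in the side
domain or its mirror image, then one by the side branch. -/
theorem agrees_two {k : ℕ} {y : ℝ} {n : ℕ} (hy : |y| < E (k + 1))
    (hmid : |F^[rSeq k] y| ∈ Ioo (P k) (Q k))
    (hret : 1 / 2 + y ∈ entrySet f (nestI f (1 / 2) (k + 1)) ∩ nestI f (1 / 2) (k + 1) ∧
      nestR f (1 / 2) (k + 1) (1 / 2 + y) = 1 / 2 + F^[n] y) (hn : n = rSeq k + tSeq k) :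
    1 / 2 + y ∈ entrySet f (nestI f (1 / 2) (k + 1)) ∩ nestI f (1 / 2) (k + 1) ∧
      (∀ j < 2, (entryMap f (nestI f (1 / 2) k))^[j] (1 / 2 + y) ∈
        entrySet f (nestI f (1 / 2) k) ∩ nestI f (1 / 2) k) ∧
      entryMap f (nestI f (1 / 2) (k + 1)) (1 / 2 + y) =
        (entryMap f (nestI f (1 / 2) k))^[2] (1 / 2 + y) := by
  obtain ⟨h1, h2⟩ := hN.central_return hy
  obtain ⟨h3, h4⟩ := hN.side_return hmid
  change entryMap f (nestI f (1 / 2) k) _ = _ at h2 h4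
  refine ⟨hret.1, fun j hj => ?_, ?_⟩
  · interval_cases j
    · exact h1
    · rw [Function.iterate_one, h2]
      exact h3
  · change nestR f (1 / 2) (k + 1) (1 / 2 + y) =
      entryMap f (nestI f (1 / 2) k) (entryMap f (nestI f (1 / 2) k) (1 / 2 + y))
    rw [h2, h4, hret.2, hn, add_comm (rSeq k), Function.iterate_add_apply]

theorem central_covers (k : ℕ) :
    nestI f (1 / 2) (k + 1) ⊆ nestR f (1 / 2) k '' nestI f (1 / 2) (k + 1) := by
  intro x hx
  obtain ⟨z, rfl⟩ : ∃ z, x = 1 / 2 + z := ⟨x - 1 / 2, by ring⟩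
  rw [hN.mem_nestI] at hx
  have hS := hN.stage k
  have hz : |-σ k * z| < E (k + 1) := by rwa [abs_sign_mul (neg_sign hS.sign)]
  rw [abs_lt] at hz
  -- On `[0, E (k+1)]` the normalised branch falls from at least `P k ≥ E (k+1)` to `-E k < -E
  -- (k+1)`, so half of the central domain already covers it.
  obtain ⟨y, hy, hyz⟩ := intermediate_value_Icc' hS.D_pos.le
    (f := fun y => -σ k * F^[rSeq k] y)
    (continuous_const.mul (hN.continuous.iterate _)).continuousOn
    (show -σ k * z ∈ Icc (-σ k * F^[rSeq k] (E (k + 1))) (-σ k * F^[rSeq k] 0) by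
      rw [hS.right]
      exact ⟨by linarith [hS.D_lt_E, hz.1], by linarith [hS.D_le, hz.2, hS.crit.1]⟩)
  have hyD : y < E (k + 1) := by
    refine lt_of_le_of_ne hy.2 fun h => ?_
    rw [h] at hyz
    simp only [hS.right] at hyz
    linarith [hS.D_lt_E, hz.1]
  have hyD' : |y| < E (k + 1) := by rwa [abs_of_nonneg hy.1]
  refine ⟨1 / 2 + y, hN.mem_nestI.2 hyD', ?_⟩
  have hne : -σ k ≠ 0 := by rcases hS.sign with h | h <;> rw [h] <;> norm_num
  rw [(hN.central_return hyD').2, mul_left_cancel₀ hne hyz]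

theorem nestCombinatorics : NestCombinatorics f (1 / 2) where
  prop1 := by
    have hit : ∀ n, f^[n] (1 / 2) = 1 / 2 + F^[n] 0 := fun n => by
      rw [← hN.iterate_eq, add_zero]
    have h3 := hN.abs_crit_mem 0
    have hq := hN.E_pos 0
    refine ⟨?_, ?_, ?_, ?_⟩
    · have := hit 1
      rw [Function.iterate_one, Function.iterate_one] at this
      rw [this]
      linarith [hN.critical_pos]
    · rw [hit, hN.revFixedPt_eq, hN.hat_eq _ ⟨by linarith, by linarith [hN.E_lt]⟩]
      have := hN.critical_iterate_lt
      change 1 / 2 + F (F 0) < _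
      linarith
    · rw [hit, hN.mem_nestI]
      exact h3.2.trans_le (hN.stage 0).Q_le
    · rw [hit, hN.mem_nestI]
      exact ((hN.stage 0).side.abs_iterate_lt hN.even h3).1
  prop2 := by
    intro k
    refine ⟨?_, ?_, ?_⟩
    · have := (hN.central_return (k := k) (y := 0) (by simpa using hN.E_pos (k + 1))).1
      rwa [add_zero] at this
    · rw [hN.nestR_crit]
      exact (hN.side_return (hN.abs_crit_mem k)).1
    · rw [disjoint_left]
      intro x hx hxJ
      obtain ⟨y, rfl⟩ : ∃ y, x = 1 / 2 + y := ⟨x - 1 / 2, by ring⟩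
      have h1 := hN.mem_nestI.1 hx
      have h2 := (hN.nestJ_abs hxJ).1
      linarith [(hN.stage k).D_le]
  prop3 := by
    refine fun k => ⟨hN.central_covers k, ?_⟩
    have := (hN.mem_nestI (k := k + 1) (y := 0)).2 (by simpa using hN.E_pos (k + 1))
    rwa [add_zero] at this
  prop4 := by
    intro k hk x hx
    obtain ⟨k, rfl⟩ := Nat.exists_eq_add_of_le' hk
    obtain ⟨y, rfl⟩ : ∃ y, x = 1 / 2 + y := ⟨x - 1 / 2, by ring⟩
    have hy := hN.mem_nestI.1 hx
    have hmid := hN.central k |y| ⟨abs_nonneg y, hy.le⟩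
    rw [iterate_abs hN.even (hN.stage k).pos] at hmid
    exact hN.agrees_two (hy.trans (hN.E_succ_lt (k + 1)))
      (hN.abs_mem_of_sign_mul_mem (neg_sign (hN.stage k).sign) hmid) (hN.central_return hy)
      (rSeq_succ k)
  prop5 := by
    intro k hk
    obtain ⟨k, rfl⟩ := Nat.exists_eq_add_of_le' hk.pos
    have hk' : Even k := by
      by_contra h
      exact (Nat.not_even_iff_odd.2 hk) (Nat.not_even_iff_odd.1 h).add_one
    have key : ∀ y, 1 / 2 + y ∈ nestJ f (1 / 2) (k + 2) →
        |y| < E (k + 1) ∧ σ k * F^[rSeq k] y ∈ Ioo (P k) (Q k) := by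
      intro y hy
      have hy' := hN.nestJ_abs hy
      refine ⟨hy'.2.trans (hN.Q_lt k), ?_⟩
      rw [← iterate_abs hN.even (hN.stage k).pos]
      exact hN.side k hk' _ (Ioo_subset_Icc_self hy')
    constructor
    · rintro _ ⟨x, hx, rfl⟩
      obtain ⟨y, rfl⟩ : ∃ y, x = 1 / 2 + y := ⟨x - 1 / 2, by ring⟩
      obtain ⟨h1, h2⟩ := key y hx
      -- In centred coordinates the hat map is `y ↦ -y`, so the point of `J` required by (5) is the
      -- mirror image of the first return.
      have h3 : -σ k * -F^[rSeq k] y ∈ Ioo (P k) (Q k) := by rwa [neg_mul_neg]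
      have h4 : |-F^[rSeq k] y| < E k := by
        rw [abs_neg]
        exact (hN.abs_mem_of_sign_mul_mem (hN.stage k).sign h2).2.trans_le (hN.stage k).Q_le
      refine ⟨1 / 2 + -F^[rSeq k] y, hN.mem_nestJ.2 h3, ?_⟩
      rw [Nat.add_sub_cancel, (hN.central_return h1).2, hN.hat_eq _ (hN.mem_unit h4)]
      ring
    · intro x hx
      obtain ⟨y, rfl⟩ : ∃ y, x = 1 / 2 + y := ⟨x - 1 / 2, by ring⟩
      obtain ⟨h1, h2⟩ := key y hx
      refine hN.agrees_two h1 (hN.abs_mem_of_sign_mul_mem (hN.stage k).sign h2)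
        (hN.side_return (hN.nestJ_abs hx)) ?_
      rw [tSeq_succ, if_neg (Nat.not_odd_iff_even.2 hk'), rSeq_succ]
  prop6 := by
    intro k hk2 hk x hx
    obtain ⟨k, rfl⟩ := Nat.exists_eq_add_of_le' (show 1 ≤ k by omega)
    have hk' : Odd k := by
      by_contra h
      exact (Nat.not_odd_iff_even.2 hk) (Nat.not_odd_iff_even.1 h).add_one
    obtain ⟨y, rfl⟩ : ∃ y, x = 1 / 2 + y := ⟨x - 1 / 2, by ring⟩
    obtain ⟨h1, h2⟩ := hN.side_return (hN.nestJ_abs hx)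
    obtain ⟨h3, h4⟩ := hN.central_return ((hN.nestJ_abs hx).2.trans (hN.Q_lt k))
    refine ⟨h1, fun j hj => ?_, ?_⟩
    · interval_cases j
      exact h3
    · change nestR f (1 / 2) (k + 1) (1 / 2 + y) = nestR f (1 / 2) k (1 / 2 + y)
      rw [h2, h4, tSeq_succ, if_pos hk']

end

end SymmetricNest

/-! ### The power family: smoothness, symmetry and fixed point -/

section PowerFamily

variable {ℓ a : ℝ}

theorem powerFamily_sub (ℓ a x : ℝ) : powerFamily ℓ a (1 - x) = powerFamily ℓ a x := by
  unfold powerFamily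
  rw [show 2 * (1 - x) - 1 = -(2 * x - 1) by ring, abs_neg]

theorem powerFamily_zero (ℓ a : ℝ) : powerFamily ℓ a 0 = 0 := by
  simp [powerFamily]

theorem powerFamily_one (ℓ a : ℝ) : powerFamily ℓ a 1 = 0 := by
  have := powerFamily_sub ℓ a 0
  rwa [sub_zero, powerFamily_zero] at this

theorem powerFamily_half (hℓ : 1 < ℓ) (a : ℝ) : powerFamily ℓ a (1 / 2) = a := by
  have : (2 * (1 / 2 : ℝ) - 1) = 0 := by norm_num
  rw [powerFamily, this, abs_zero, Real.zero_rpow (by linarith)]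
  ring

theorem powerFamily_lt_iff (hℓ : 1 < ℓ) (ha : 0 < a) {x y : ℝ} :
    powerFamily ℓ a x < powerFamily ℓ a y ↔ |2 * y - 1| < |2 * x - 1| := by
  unfold powerFamily
  rw [mul_lt_mul_iff_right₀ ha, sub_lt_sub_iff_left,
    Real.rpow_lt_rpow_iff (abs_nonneg _) (abs_nonneg _) (by linarith)]

theorem powerFamily_strictMonoOn (hℓ : 1 < ℓ) (ha : 0 < a) :
    StrictMonoOn (powerFamily ℓ a) (Icc 0 (1 / 2)) := by
  intro x hx y hy hxy
  rw [powerFamily_lt_iff hℓ ha, abs_of_nonpos (by linarith [hy.2]),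
    abs_of_nonpos (by linarith [hx.2])]
  linarith

theorem powerFamily_strictAntiOn (hℓ : 1 < ℓ) (ha : 0 < a) :
    StrictAntiOn (powerFamily ℓ a) (Ici (1 / 2)) := by
  intro x hx y hy hxy
  have hx' : 1 / 2 ≤ x := hx
  have hy' : 1 / 2 ≤ y := hy
  rw [powerFamily_lt_iff hℓ ha, abs_of_nonneg (by linarith), abs_of_nonneg (by linarith)]
  linarith

theorem continuous_powerFamily (hℓ : 1 < ℓ) :
    Continuous fun p : ℝ × ℝ => powerFamily ℓ p.1 p.2 := by
  unfold powerFamily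
  refine continuous_fst.mul (continuous_const.sub (Continuous.rpow_const ?_ fun _ => Or.inr ?_))
  · fun_prop
  · linarith

theorem isUnimodal_powerFamily (hℓ : 1 < ℓ) (ha : a ∈ Ioo (0 : ℝ) 1) :
    IsUnimodal (powerFamily ℓ a) (1 / 2) where
  continuousOn :=
    ((continuous_powerFamily hℓ).comp (by fun_prop : Continuous fun x : ℝ => (a, x))).continuousOn
  mapsTo := by
    intro x hx
    have h0 : 0 ≤ |2 * x - 1| ^ ℓ := Real.rpow_nonneg (abs_nonneg _) _
    have h1 : |2 * x - 1| ^ ℓ ≤ 1 :=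
      Real.rpow_le_one (abs_nonneg _) (abs_le.2 ⟨by linarith [hx.1], by linarith [hx.2]⟩)
        (by linarith)
    unfold powerFamily
    refine ⟨mul_nonneg ha.1.le (by linarith), ?_⟩
    exact (mul_le_of_le_one_right ha.1.le (by linarith)).trans ha.2.le
  turning_mem := by constructor <;> norm_num
  strictMonoOn := powerFamily_strictMonoOn hℓ ha.1
  strictAntiOn := (powerFamily_strictAntiOn hℓ ha.1).mono fun _ hx => hx.1

/-- Affine charts suffice: with `φ x = 1/2 + x/2` and `ψ y = a + a y`, the map becomes `x ↦ -|x| ^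
ℓ`. -/
theorem isNonflat_powerFamily (hℓ : 1 < ℓ) (ha : 0 < a) :
    IsNonflat (powerFamily ℓ a) (1 / 2) ℓ := by
  refine ⟨((Homeomorph.mulLeft₀ (1 / 2 : ℝ) (by norm_num)).trans
      (Homeomorph.addLeft (1 / 2 : ℝ))).toOpenPartialHomeomorph,
    ((Homeomorph.mulLeft₀ a ha.ne').trans (Homeomorph.addLeft a)).toOpenPartialHomeomorph,
    ⟨mem_univ _, ?_, ?_, ?_⟩, ⟨mem_univ _, ?_, ?_, ?_⟩, Eventually.of_forall fun x => ?_⟩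
  · exact (by fun_prop : ContDiff ℝ 3 fun x : ℝ => 1 / 2 + 1 / 2 * x).contDiffOn
  · exact (by fun_prop : ContDiff ℝ 3 fun x : ℝ => (1 / 2)⁻¹ * (-(1 / 2) + x)).contDiffOn
  · change 1 / 2 + 1 / 2 * (0 : ℝ) = 1 / 2
    norm_num
  · exact (by fun_prop : ContDiff ℝ 3 fun x : ℝ => a + a * x).contDiffOn
  · exact (by fun_prop : ContDiff ℝ 3 fun x : ℝ => a⁻¹ * (-a + x)).contDiffOn
  · rw [powerFamily_half hℓ]
    change a + a * (0 : ℝ) = a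
    ring
  · change |a⁻¹ * (-a + powerFamily ℓ a (1 / 2 + 1 / 2 * x))| = |x| ^ ℓ
    unfold powerFamily
    rw [show 2 * (1 / 2 + 1 / 2 * x) - 1 = x by ring,
      show a⁻¹ * (-a + a * (1 - |x| ^ ℓ)) = -|x| ^ ℓ by field_simp; ring, abs_neg,
      abs_of_nonneg (Real.rpow_nonneg (abs_nonneg _) _)]

theorem isSmoothUnimodal_powerFamily (hℓ : 1 < ℓ) (ha : a ∈ Ioo (0 : ℝ) 1) :
    IsSmoothUnimodal (powerFamily ℓ a) (1 / 2) ℓ where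
  toIsUnimodal := isUnimodal_powerFamily hℓ ha
  contDiffOn := by
    intro x hx
    have hx' : 2 * x - 1 ≠ 0 := fun h => hx.2 (by rw [mem_singleton_iff]; linarith)
    apply ContDiffAt.contDiffWithinAt
    have h1 : ContDiffAt ℝ 3 (fun x : ℝ => 2 * x - 1) x := by fun_prop
    exact contDiffAt_const.mul (contDiffAt_const.sub ((h1.abs hx').rpow_const_of_ne
      (abs_ne_zero.2 hx')))
  deriv_ne_zero := by
    intro x hx hxc
    have hx' : 2 * x - 1 ≠ 0 := fun h => hxc (by linarith)
    have h1 : HasDerivAt (fun x : ℝ => 2 * x - 1) 2 x := by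
      simpa using ((hasDerivAt_id x).const_mul 2).sub_const 1
    have h2 := (((hasDerivAt_abs_rpow (2 * x - 1) hℓ).comp x h1).const_sub 1).const_mul a
    have h3 : HasDerivAt (powerFamily ℓ a) _ x := h2
    rw [h3.hasDerivWithinAt.derivWithin (uniqueDiffOn_Icc one_pos x hx)]
    have h4 : |2 * x - 1| ^ (ℓ - 2) ≠ 0 := (Real.rpow_pos_of_pos (abs_pos.2 hx') _).ne'
    have h5 : ℓ ≠ 0 := by linarith
    have h6 := ha.1.ne'
    simp [h4, h5, h6, hx']
  one_lt_order := hℓ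
  nonflat := isNonflat_powerFamily hℓ ha.1

theorem hat_powerFamily (hℓ : 1 < ℓ) (ha : 0 < a) {x : ℝ} (hx : x ∈ Icc (0 : ℝ) 1) :
    hat (powerFamily ℓ a) x = 1 - x := by
  unfold hat
  split_ifs with h
  · obtain ⟨-, h2, h3⟩ := h.choose_spec
    set y := h.choose
    have h4 : |2 * y - 1| = |2 * x - 1| :=
      le_antisymm (not_lt.1 fun hlt => h2.not_lt ((powerFamily_lt_iff hℓ ha).2 hlt))
        (not_lt.1 fun hlt => h2.not_gt ((powerFamily_lt_iff hℓ ha).2 hlt))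
    rcases abs_eq_abs.1 h4 with h5 | h5
    · exact absurd (by linarith) h3
    · linarith
  · by_contra hne
    exact h ⟨1 - x, ⟨by linarith [hx.2], by linarith [hx.1]⟩, powerFamily_sub ℓ a x,
      fun h' => hne h'.symm⟩

theorem revFixedPt_powerFamily (hℓ : 1 < ℓ) (ha : 0 < a) {q : ℝ} (hq : 1 / 2 < q) (hq1 : q ≤ 1)
    (hfix : powerFamily ℓ a q = q) : revFixedPt (powerFamily ℓ a) (1 / 2) = q := by
  obtain ⟨h1, -, h3⟩ := Classical.epsilon_spec
    (p := fun x => 1 / 2 < x ∧ x ≤ 1 ∧ powerFamily ℓ a x = x) ⟨q, hq, hq1, hfix⟩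
  change 1 / 2 < revFixedPt (powerFamily ℓ a) (1 / 2) at h1
  change powerFamily ℓ a (revFixedPt (powerFamily ℓ a) (1 / 2)) =
    revFixedPt (powerFamily ℓ a) (1 / 2) at h3
  have hanti := powerFamily_strictAntiOn hℓ ha
  rcases lt_trichotomy (revFixedPt (powerFamily ℓ a) (1 / 2)) q with h | h | h
  · have := hanti h1.le hq.le h
    linarith
  · exact h
  · have := hanti hq.le h1.le h
    linarith

/-! ### The initial parameter interval -/

/-- The power family in the coordinate centred at the turning point. -/
noncomputable def centredPower (ℓ a y : ℝ) : ℝ := powerFamily ℓ a (1 / 2 + y) - 1 / 2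

theorem continuous_centredPower (hℓ : 1 < ℓ) :
    Continuous fun p : ℝ × ℝ => centredPower ℓ p.1 p.2 :=
  ((continuous_powerFamily hℓ).comp
    (by fun_prop : Continuous fun p : ℝ × ℝ => (p.1, 1 / 2 + p.2))).sub continuous_const

theorem centredPower_neg (ℓ a y : ℝ) : centredPower ℓ a (-y) = centredPower ℓ a y := by
  unfold centredPower
  rw [← powerFamily_sub]
  congr 2
  ring

theorem centredPower_strictAntiOn (hℓ : 1 < ℓ) (ha : 0 < a) :
    StrictAntiOn (centredPower ℓ a) (Ici 0) := by
  intro x hx y hy hxy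
  have hx' : 0 ≤ x := hx
  have hy' : 0 ≤ y := hy
  have := powerFamily_strictAntiOn hℓ ha (show 1 / 2 + x ∈ Ici (1 / 2) by simpa using hx')
    (show 1 / 2 + y ∈ Ici (1 / 2) by simpa using hy') (by linarith)
  unfold centredPower
  linarith

theorem centredPower_zero (hℓ : 1 < ℓ) (a : ℝ) : centredPower ℓ a 0 = a - 1 / 2 := by
  rw [centredPower, add_zero, powerFamily_half hℓ]

theorem centredPower_half (ℓ a : ℝ) : centredPower ℓ a (1 / 2) = -(1 / 2) := by
  rw [centredPower, add_halves, powerFamily_one, zero_sub]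

/-- For some parameter `a > 1/2`, the second iterate of the turning point is on its right. -/
theorem exists_critical_iterate_pos (hℓ : 1 < ℓ) :
    ∃ a : ℝ, 1 / 2 < a ∧ a < 1 ∧ 0 < centredPower ℓ a (centredPower ℓ a 0) := by
  -- This `s` satisfies `s ^ ℓ = s / 4`. With `a = (1 + s) / 2` the critical value is `s / 2` and
  -- the second iterate is `s (3 - s) / 8 > 0`.
  set s : ℝ := (1 / 4) ^ (1 / (ℓ - 1)) with hs
  have hℓ' : ℓ - 1 ≠ 0 := by linarith
  have hs0 : 0 < s := Real.rpow_pos_of_pos (by norm_num) _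
  have hs1 : s < 1 := Real.rpow_lt_one (by norm_num) (by norm_num) (by
    apply one_div_pos.2
    linarith)
  have hsℓ : s ^ ℓ = 1 / 4 * s := by
    have h1 : s ^ (ℓ - 1) = 1 / 4 := by
      rw [hs, ← Real.rpow_mul (by norm_num), one_div_mul_cancel hℓ', Real.rpow_one]
    rw [← h1, ← Real.rpow_add_one hs0.ne']
    congr 1
    ring
  refine ⟨(1 + s) / 2, by linarith, by linarith, ?_⟩
  rw [centredPower_zero hℓ, centredPower, powerFamily,
    show 2 * (1 / 2 + ((1 + s) / 2 - 1 / 2)) - 1 = s by ring, abs_of_pos hs0, hsℓ]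
  nlinarith

/-- The first stage of the nest, in terms of the fixed point `E`, a preimage `w` of `-E` and a
preimage `D` of `w`. -/
theorem stage_zero {F : ℝ → ℝ} (hF : ∀ y, F (-y) = F y) (hanti : StrictAntiOn F (Ici 0))
    {E w D : ℝ} (hE : 0 < E) (hFE : F E = E) (hw : E ≤ w) (hFw : F w = -E) (hD : D ∈ Icc 0 E)
    (hFD : F D = w) (hX : -1 * F^[3] 0 ∈ Icc D E) : Stage F 3 2 1 (-1) E D D E := by
  have h3 : ∀ y, F^[3] y = F (F (F y)) := fun _ => rfl
  have h2 : ∀ y, F^[2] y = F (F y) := fun _ => rfl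
  have hDE : D < E := by
    refine lt_of_le_of_ne hD.2 ?_
    rintro rfl
    have : D = -D := by rw [← hFw, ← hFD, hFE, hFE]
    linarith
  have hD0 : 0 < D := by
    refine lt_of_le_of_ne hD.1 ?_
    rintro rfl
    have := hX.1
    rw [h3, hFD, hFw, hF, hFE] at this
    linarith
  have hw0 : w ∈ Ici (0 : ℝ) := hE.le.trans hw
  have hle : ∀ y ∈ Icc 0 D, w ≤ F y := fun y hy => by
    rw [← hFD]
    exact hanti.antitoneOn hy.1 hD.1 hy.2
  have hle2 : ∀ y ∈ Icc 0 D, F (F y) ≤ -E := fun y hy => by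
    rw [← hFw]
    exact hanti.antitoneOn hw0 (hE.le.trans (hw.trans (hle y hy))) (hle y hy)
  have hge : ∀ y ∈ Icc D E, E ≤ F y := fun y hy => by
    conv_lhs => rw [← hFE]
    exact hanti.antitoneOn (hD.1.trans hy.1) hE.le hy.2
  -- Everything follows from the orbit `D ↦ w ↦ -E ↦ E`. At this level the noncentral domain fills
  -- the gap between the central domain and the boundary: `P = D` and `Q = E`.
  refine ⟨Or.inl rfl, by norm_num, hD0, le_rfl, le_rfl, ?_, ?_, ?_,
    ⟨Or.inr rfl, by norm_num, hDE, ?_, ?_, ?_, ?_⟩, hX⟩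
  · intro y hy z hz hyz
    have e1 := hanti hy.1 hz.1 hyz
    have e2 := hanti (hw0.out.trans (hle z hz)) (hw0.out.trans (hle y hy)) e1
    have e3 : F (-F (F z)) < F (-F (F y)) → F (F (F z)) < F (F (F y)) := by
      rw [hF, hF]
      exact id
    have hz2 := hle2 z hz
    have hy2 := hle2 y hy
    -- The second iterates are at most `-E`, where `F` increases; evenness moves the comparison to
    -- the half-line on which `F` decreases.
    have e4 := hanti (show -F (F z) ∈ Ici 0 from by rw [mem_Ici]; linarith)
      (show -F (F y) ∈ Ici 0 from by rw [mem_Ici]; linarith) (neg_lt_neg e2)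
    rw [hF, hF] at e4
    simp only [h3]
    linarith
  · rw [h3, hFD, hFw, hF, hFE]
    ring
  · intro y hy j h1 h2'
    interval_cases j
    · exact (hw.trans (hle y hy)).trans (le_abs_self _)
    · have := hle2 y hy
      exact (by linarith : E ≤ -F (F y)).trans (neg_le_abs _)
  · intro y hy z hz hyz
    have e1 := hanti (hD.1.trans hy.1) (hD.1.trans hz.1) hyz
    have e2 := hanti (hE.le.trans (hge z hz)) (hE.le.trans (hge y hy)) e1
    simp only [h2]
    linarith
  · rw [h2, hFD, hFw]
    ring
  · rw [h2, hFE, hFE]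
    ring
  · intro y hy j h1 h2'
    interval_cases j
    exact (hge y hy).trans (le_abs_self _)

/-- At the parameter `γ` where the critical value equals `w`, the orbit `0 ↦ w ↦ -E ↦ E` gives
`-F^3(0) = -E < D`. At `a = 1` the orbit `0 ↦ 1/2 ↦ -1/2 ↦ -1/2` gives `-F^3(0) = 1/2 > E`. So
`-F^3(0)` crosses `[D, E]` in between. -/
theorem exists_familyAt_zero (hℓ : 1 < ℓ) :
    ∃ s : FamilyAt (centredPower ℓ) 0, ∀ a ∈ Icc s.α s.β, 1 / 2 < a ∧ a < 1 ∧
      s.E a < 1 / 2 ∧ centredPower ℓ a (s.E a) = s.E a ∧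
      centredPower ℓ a (centredPower ℓ a 0) < -s.E a := by
  obtain ⟨a₁, ha₁, ha₁', hpos⟩ := exists_critical_iterate_pos hℓ
  have hFc := continuous_centredPower hℓ
  have hhalf : ∀ a ∈ Icc a₁ 1, 1 / 2 < a := fun a ha => ha₁.trans_le ha.1
  have hanti : ∀ a ∈ Icc a₁ 1, StrictAntiOn (centredPower ℓ a) (Ici 0) := fun a ha =>
    centredPower_strictAntiOn hℓ (by linarith [hhalf a ha])
  obtain ⟨E, hEc, hE⟩ := exists_continuousOn_solution (K := Icc a₁ 1) (u := fun _ => 0)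
    (v := fun _ => 1 / 2) (y := fun _ => 0) (G := fun a y => centredPower ℓ a y - y)
    (hFc.sub continuous_snd) continuousOn_const continuousOn_const continuousOn_const
    (fun _ _ => by norm_num)
    (fun a ha x hx y hy hxy => by
      have := hanti a ha hx.1 hy.1 hxy
      simp only
      linarith)
    (fun a ha => by
      rw [centredPower_zero hℓ, centredPower_half]
      constructor <;> linarith [hhalf a ha])
  have hFE : ∀ a ∈ Icc a₁ 1, centredPower ℓ a (E a) = E a := fun a ha =>
    sub_eq_zero.1 (hE a ha).2
  have hE0 : ∀ a ∈ Icc a₁ 1, 0 < E a := by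
    intro a ha
    refine lt_of_le_of_ne (hE a ha).1.1 fun h => ?_
    have := hFE a ha
    rw [← h, centredPower_zero hℓ] at this
    linarith [hhalf a ha]
  have hE1 : ∀ a ∈ Icc a₁ 1, E a < 1 / 2 := by
    intro a ha
    refine lt_of_le_of_ne (hE a ha).1.2 fun h => ?_
    have := hFE a ha
    rw [h, centredPower_half] at this
    linarith
  obtain ⟨w, hwc, hw⟩ := exists_continuousOn_solution (K := Icc a₁ 1) (u := E)
    (v := fun _ => 1 / 2) (y := fun a => -E a) hFc hEc continuousOn_const hEc.neg
    (fun a ha => (hE1 a ha).le)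
    (fun a ha => (hanti a ha).mono fun x hx => (hE0 a ha).le.trans hx.1)
    (fun a ha => by
      rw [hFE a ha, centredPower_half]
      constructor <;> linarith [hE0 a ha, hE1 a ha])
  have hmem₁ : a₁ ∈ Icc a₁ 1 := ⟨le_rfl, ha₁'.le⟩
  -- At `a₁` the second critical iterate is positive, so the critical value cannot exceed `w`.
  -- Taking the last coincidence keeps it at least `w` from `γ` on, so that `w` has a preimage `D`
  -- in `[0, E]`.
  obtain ⟨γ, hγ, hzγ, hz⟩ := exists_last_zero (z := fun a => centredPower ℓ a 0 - w a) ha₁'.le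
    ((hFc.comp (by fun_prop : Continuous fun a : ℝ => (a, (0 : ℝ)))).continuousOn.sub hwc)
    (by
      by_contra hcon
      have h1 : w a₁ < centredPower ℓ a₁ 0 := by linarith
      have h2 := hanti a₁ hmem₁ ((hE0 a₁ hmem₁).le.trans (hw a₁ hmem₁).1.1)
        ((hE0 a₁ hmem₁).le.trans ((hw a₁ hmem₁).1.1.trans h1.le)) h1
      rw [(hw a₁ hmem₁).2] at h2
      linarith [hE0 a₁ hmem₁])
    (by
      have := (hw 1 ⟨ha₁'.le, le_rfl⟩).1.2
      rw [centredPower_zero hℓ]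
      linarith)
  have hsub : Icc γ 1 ⊆ Icc a₁ 1 := Icc_subset_Icc_left hγ.1
  obtain ⟨D, hDc, hD⟩ := exists_continuousOn_solution (K := Icc γ 1) (u := fun _ => 0)
    (v := E) (y := w) hFc continuousOn_const (hEc.mono hsub) (hwc.mono hsub)
    (fun a ha => (hE0 a (hsub ha)).le)
    (fun a ha => (hanti a (hsub ha)).mono fun x hx => hx.1)
    (fun a ha => by
      rw [hFE a (hsub ha)]
      exact ⟨(hw a (hsub ha)).1.1, by linarith [hz a ha]⟩)
  have hDE : ∀ a ∈ Icc γ 1, D a < E a := by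
    intro a ha
    refine lt_of_le_of_ne (hD a ha).1.2 fun h => ?_
    have h1 := (hD a ha).2
    have h2 := (hw a (hsub ha)).2
    rw [h, hFE a (hsub ha)] at h1
    rw [← h1, hFE a (hsub ha)] at h2
    linarith [hE0 a (hsub ha)]
  have h3 : ∀ a, (centredPower ℓ a)^[3] 0 =
      centredPower ℓ a (centredPower ℓ a (centredPower ℓ a 0)) := fun _ => rfl
  have hγγ : γ ∈ Icc γ 1 := ⟨le_rfl, hγ.2⟩
  have h11 : (1 : ℝ) ∈ Icc γ 1 := ⟨hγ.2, le_rfl⟩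
  obtain ⟨α, β, hα, hαβ, hβ, hends, hX⟩ := exists_crossing (u := D) (v := E)
    (y := fun a => -1 * (centredPower ℓ a)^[3] 0) hγ.2 hDc (hEc.mono hsub)
    (continuous_const.mul ((continuous_iterate_family hFc 3).comp
      (by fun_prop : Continuous fun a : ℝ => (a, (0 : ℝ))))).continuousOn hDE
    (by
      refine Or.inl ⟨?_, ?_⟩
      · rw [h3, show centredPower ℓ γ 0 = w γ by linarith, (hw γ (hsub hγγ)).2,
          centredPower_neg, hFE γ (hsub hγγ)]
        linarith [hE0 γ (hsub hγγ), (hD γ hγγ).1.1]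
      · rw [h3, centredPower_zero hℓ, show (1 : ℝ) - 1 / 2 = 1 / 2 by norm_num,
          centredPower_half, centredPower_neg, centredPower_half]
        linarith [hE1 1 (hsub h11)])
  have hsub' : Icc α β ⊆ Icc γ 1 := Icc_subset_Icc hα.le hβ.le
  have hstage : ∀ a ∈ Icc α β, Stage (centredPower ℓ a) 3 2 1 (-1) (E a) (D a) (D a) (E a) :=
    fun a ha => stage_zero (centredPower_neg ℓ a) (hanti a (hsub (hsub' ha)))
      (hE0 a (hsub (hsub' ha))) (hFE a (hsub (hsub' ha))) (hw a (hsub (hsub' ha))).1.1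
      (hw a (hsub (hsub' ha))).2 (hD a (hsub' ha)).1 (hD a (hsub' ha)).2 (hX a ha)
  have hEc' := hEc.mono (hsub'.trans hsub)
  have hDc' := hDc.mono hsub'
  refine ⟨⟨α, β, 1, -1, E, D, D, E, hαβ, hEc', hDc', hDc', hEc', hstage, hends⟩,
    fun a ha => ?_⟩
  have ha' := hsub' ha
  have ha'' := hsub ha'
  refine ⟨hhalf a ha'', ha.2.trans_lt hβ, hE1 a ha'', hFE a ha'', ?_⟩
  have h1 := hanti a ha'' self_mem_Ici (hstage a ha).D_pos.le (hstage a ha).D_pos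
  rw [(hD a ha').2] at h1
  have hw0 := (hE0 a ha'').le.trans (hw a ha'').1.1
  have h2 := hanti a ha'' hw0 (hw0.trans h1.le) h1
  rwa [(hw a ha'').2] at h2

theorem exists_nestCombinatorics_powerFamily (hℓ : 1 < ℓ) :
    ∃ a ∈ Ioo (0 : ℝ) 1, NestCombinatorics (powerFamily ℓ a) (1 / 2) := by
  obtain ⟨s, hs⟩ := exists_familyAt_zero hℓ
  obtain ⟨a, ha, σ, τ, E, P, Q, hN, hE⟩ :=
    s.exists_centredNest (continuous_centredPower hℓ) (centredPower_neg ℓ)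
  obtain ⟨h1, h2, h3, h4, h5⟩ := hs a ha
  rw [← hE] at h3 h4 h5
  have ha0 : 0 < a := by linarith
  have happ : ∀ y, powerFamily ℓ a (1 / 2 + y) = 1 / 2 + centredPower ℓ a y := fun y => by
    unfold centredPower
    ring
  have hE0 := (hN.stage 0).E_pos
  have hSN : SymmetricNest (powerFamily ℓ a) (centredPower ℓ a) σ τ E P Q :=
    { toCentredNest := hN
      apply_eq := happ
      even := centredPower_neg ℓ a
      continuous := (continuous_centredPower hℓ).comp
        (by fun_prop : Continuous fun y : ℝ => (a, y))
      E_lt := h3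
      fixed := h4
      revFixedPt_eq := revFixedPt_powerFamily hℓ ha0 (by linarith) (by linarith)
        (by rw [happ, h4])
      hat_eq := fun x hx => hat_powerFamily hℓ ha0 hx
      critical_pos := by
        rw [centredPower_zero hℓ]
        linarith
      critical_iterate_lt := h5 }
  exact ⟨a, ⟨ha0, h2⟩, hSN.nestCombinatorics⟩

end PowerFamily

end UnimodalNest

theorem proposition6p3 :
    -- There is a unimodal map with the prescribed combinatorics.
    (∃ (f : ℝ → ℝ) (c ℓ : ℝ), UnimodalNest.IsSmoothUnimodal f c ℓ ∧ f 0 = 0 ∧ f 1 = 0 ∧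
      UnimodalNest.NestCombinatorics f c) ∧
    -- It can be found in each of the families `a (1 - |2x - 1| ^ ℓ)`, `ℓ > 1`.
    (∀ ℓ : ℝ, 1 < ℓ → ∃ a ∈ Set.Ioo (0 : ℝ) 1,
      UnimodalNest.IsSmoothUnimodal (UnimodalNest.powerFamily ℓ a) (1 / 2) ℓ ∧
      UnimodalNest.powerFamily ℓ a 0 = 0 ∧ UnimodalNest.powerFamily ℓ a 1 = 0 ∧
      UnimodalNest.NestCombinatorics (UnimodalNest.powerFamily ℓ a) (1 / 2)) ∧
    -- For every unimodal map with these combinatorics, `r_k` and `t_k` are the first return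
    -- times of `c` and of `R_{I_k}(c)` to `I_k`.
    (∀ (f : ℝ → ℝ) (c : ℝ), UnimodalNest.IsUnimodal f c → f 0 = 0 → f 1 = 0 →
      UnimodalNest.NestCombinatorics f c → ∀ k : ℕ,
        IsLeast {n : ℕ | 1 ≤ n ∧ f^[n] c ∈ UnimodalNest.nestI f c k} (UnimodalNest.rSeq k) ∧
        IsLeast {n : ℕ | 1 ≤ n ∧
          f^[n] (UnimodalNest.nestR f c k c) ∈ UnimodalNest.nestI f c k}
          (UnimodalNest.tSeq k)) := by
  refine ⟨?_, fun ℓ hℓ => ?_, fun f c hf h0 h1 hN k =>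
    UnimodalNest.isLeast_return_times hf h0 h1 hN k⟩
  · obtain ⟨a, ha, hN⟩ := UnimodalNest.exists_nestCombinatorics_powerFamily one_lt_two
    exact ⟨_, _, _, UnimodalNest.isSmoothUnimodal_powerFamily one_lt_two ha,
      UnimodalNest.powerFamily_zero _ _, UnimodalNest.powerFamily_one _ _, hN⟩
  · obtain ⟨a, ha, hN⟩ := UnimodalNest.exists_nestCombinatorics_powerFamily hℓ
    exact ⟨a, ha, UnimodalNest.isSmoothUnimodal_powerFamily hℓ ha,
      UnimodalNest.powerFamily_zero _ _, UnimodalNest.powerFamily_one _ _, hN⟩
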